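/- Let $0<T\le\infty$. A semi-infinite Volterra lattice on $[0,T)$ is a family of positive functions $a_n(t)$, $n\ge 0$, $t\in[0,T)$, with $\dot a_n=a_n(a_{n+1}-a_{n-1})$ for $n\ge 0$, where $a_{-1}=0$. It has a finite logarithmic Hamiltonian if for every $t\in[0,T)$ the series $H_0(t)=\frac12\sum_{n\ge 0}\ln a_n(t)$ converges (its partial sums have a finite limit). Its Lax operator $\mathcal L(t)$ is the self-adjoint operator on $\ell^2(\mathbb Z_+)$ generated by the symmetric tridiagonal matrix with zero diagonal and off-diagonal entries $L_{n,n+1}=L_{n+1,n}=\sqrt{a_n(t)}$, and its spectral measure is $d(E_\lambda e_0,e_0)$, where $E_\lambda$ is its resolution of the identity and $e_0$ the first standard basis vector. Consider on the other side the families $d\rho(\lambda,t)$, $t\in[0,T)$, of measures on $\mathbb R$ that evolve by $$d\rho(\lambda,t)=\frac{e^{\lambda^2t}\,d\rho(\lambda,0)}{\int_{\mathbb R} e^{\lambda^2t}\,d\rho(\lambda,0)}$$ and such that, for every $t\in[0,T)$, $d\rho(\lambda,t)$ is an even probability measure with finite moments $s_k(t)=\int\lambda^k\,d\rho(\lambda,t)$,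 whose essential support (the support without its isolated points) is $[-2,2]$, which has at most countably many mass points outside $[-2,2]$, these accumulating at no real points other than $\pm2$, and whose Hankel determinants $\Delta_n=\det(s_{i+j})_{i,j=0}^n$ satisfy $$0<\lim_{n\to\infty}\frac{\Delta_{n+1}}{\Delta_n}<\infty$$ (the limit exists, is positive and finite). Then there is a one-to-one correspondence between the semi-infinite Volterra lattices on $[0,T)$ with finite logarithmic Hamiltonian and these families of measures. It sends a lattice to the spectral measures $d\rho(\lambda,t)$ of its Lax operators $\mathcal L(t)$, $t\in[0,T)$, which are bounded, and its inverse sends a family $d\rho(\lambda,t)$ to the lattice $$a_n(t)=\frac{\Delta_{n+1}(t)\,\Delta_{n-1}(t)}{\Delta_n(t)^2},\qquad n\ge 0,\quad \Delta_{-1}=1.$$ -/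

import Mathlib

open MeasureTheory Filter Topology Set

noncomputable section

/-- The time interval `[0, T)` with `T ∈ [-∞, ∞]`. -/
def timeInterval (T : EReal) : Set ℝ := {t : ℝ | 0 ≤ t ∧ (t : EReal) < T}

/-- The initial time `0`, as a point of `[0, T)`. -/
def initialTime {T : EReal} (hT : 0 < T) : timeInterval T :=
  ⟨0, le_rfl, by simpa using hT⟩

/-! ### Semi-infinite Volterra lattices -/

/-- The left neighbour `a_{n-1}` of a site of the semi-infinite lattice, with `a_{-1} = 0`. -/
def leftNeighbour (a : ℕ → ℝ) (n : ℕ) : ℝ := if n = 0 then 0 else a (n - 1)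

/-- `a` is a positive solution on `[0, T)` of the semi-infinite Volterra lattice
`a_n' = a_n (a_{n+1} - a_{n-1})`, `n ≥ 0`, `a_{-1} = 0`.
The derivative is taken within `[0, T)` (so it is one-sided at the initial time) and therefore
does not depend on how `a_n` is extended to the real line. -/
structure IsVolterraLattice (T : EReal) (a : timeInterval T → ℕ → ℝ) : Prop where
  pos : ∀ t n, 0 < a t n
  ode : ∀ (t : timeInterval T) (n : ℕ),
    HasDerivWithinAt (Function.extend Subtype.val (fun s : timeInterval T => a s n) 0)
      (a t n * (a t (n + 1) - leftNeighbour (a t) n)) (timeInterval T) (t : ℝ)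

/-- The logarithmic Hamiltonian `H₀ = (1/2) ∑ ln a_n` is finite: the partial sums of the series
have a finite limit. -/
def HasFiniteLogHamiltonian (a : ℕ → ℝ) : Prop :=
  ∃ H : ℝ, Tendsto (fun N : ℕ => (1 / 2 : ℝ) * ∑ n ∈ Finset.range N, Real.log (a n))
    atTop (𝓝 H)

/-- The semi-infinite Volterra lattices on `[0, T)` whose logarithmic Hamiltonian is finite
(at all times). -/
def FiniteHamiltonianLattices (T : EReal) : Set (timeInterval T → ℕ → ℝ) :=
  {a | IsVolterraLattice T a ∧ ∀ t, HasFiniteLogHamiltonian (a t)}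

/-! ### The Lax operator and its spectral measure -/

/-- The Hilbert space of complex square-summable sequences. -/
abbrev SeqSpace : Type := lp (fun _ : ℕ => ℂ) 2

/-- The standard orthonormal basis of the sequence space. -/
def stdVec (n : ℕ) : SeqSpace := lp.single 2 n (1 : ℂ)

/-- The Lax matrix of the lattice: the symmetric tridiagonal matrix with zero diagonal and
off-diagonal entries `L_{n,n+1} = L_{n+1,n} = √a_n`. -/
def laxMatrix (a : ℕ → ℝ) : Matrix ℕ ℕ ℝ := fun i j =>
  if j = i + 1 then √(a i) else if i = j + 1 then √(a j) else 0

/-- `L` is the bounded self-adjoint operator on the sequence space generated by the Lax matrix.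
(A bounded operator is determined by its matrix entries.) -/
def IsLaxOperator (a : ℕ → ℝ) (L : SeqSpace →L[ℂ] SeqSpace) : Prop :=
  IsSelfAdjoint L ∧ ∀ i j : ℕ, inner ℂ (stdVec i) (L (stdVec j)) = ((laxMatrix a i j : ℝ) : ℂ)

/-- `μ` is the spectral measure `d(E_λ v, v)` of the bounded self-adjoint operator `L` at the
vector `v`, that is, `∫ f dμ = (f(L) v, v)` for all bounded continuous real functions `f`, where
`f(L) = ∫ f(λ) dE_λ` is given by the functional calculus. -/
def IsSpectralMeasureAt {H : Type*} [NormedAddCommGroup H] [InnerProductSpace ℂ H]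
    [CompleteSpace H] (L : H →L[ℂ] H) (v : H) (μ : Measure ℝ) : Prop :=
  IsSelfAdjoint L ∧ IsFiniteMeasure μ ∧
    ∀ f : BoundedContinuousFunction ℝ ℝ,
      ((∫ x, f x ∂μ : ℝ) : ℂ) = inner ℂ v (cfc (fun x : ℝ => f x) L v)

/-- `μ` is the spectral measure `d(E_λ e₀, e₀)` of the Lax operator of the lattice. -/
def IsLaxSpectralMeasure (a : ℕ → ℝ) (μ : Measure ℝ) : Prop :=
  ∃ L : SeqSpace →L[ℂ] SeqSpace, IsLaxOperator a L ∧ IsSpectralMeasureAt L (stdVec 0) μ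

/-! ### The class of measures -/

/-- The moment `s_k = ∫ λ^k dμ(λ)`. -/
def momentOf (μ : Measure ℝ) (k : ℕ) : ℝ := ∫ x, x ^ k ∂μ

/-- The Hankel determinant of size `k × k` built from the moments. In the usual indexing it is
`Δ_{k-1} = det (s_{i+j})_{i,j=0}^{k-1}`; the empty determinant gives `Δ_{-1} = 1`. -/
def hankelDet (μ : Measure ℝ) (k : ℕ) : ℝ :=
  (Matrix.of fun i j : Fin k => momentOf μ ((i : ℕ) + (j : ℕ))).det

/-- `Δ_{n+1} Δ_{n-1} / Δ_n²`. -/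
def hankelCoeff (μ : Measure ℝ) (n : ℕ) : ℝ :=
  hankelDet μ (n + 2) * hankelDet μ n / hankelDet μ (n + 1) ^ 2

/-- The essential support of a measure on the line: the support without its isolated points. -/
def essentialSupport (μ : Measure ℝ) : Set ℝ := μ.support ∩ derivedSet μ.support

/-- The mass points of `μ` outside `[-2, 2]`. -/
def outerMassPoints (μ : Measure ℝ) : Set ℝ := {x : ℝ | x ∉ Icc (-2 : ℝ) 2 ∧ μ {x} ≠ 0}

/-- Even probability measures with finite moments, with essential support `[-2, 2]` and at most
countably many mass points outside it, which accumulate only at `±2`, and such that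
`0 < lim Δ_{n+1} / Δ_n < ∞`. -/
structure IsAdmissible (μ : Measure ℝ) : Prop where
  prob : IsProbabilityMeasure μ
  even : μ.map (fun x => -x) = μ
  moments : ∀ k : ℕ, Integrable (fun x : ℝ => x ^ k) μ
  essential : essentialSupport μ = Icc (-2) 2
  countable : (outerMassPoints μ).Countable
  accumulation : derivedSet (outerMassPoints μ) ⊆ {-2, 2}
  hankel : ∃ l : ℝ, 0 < l ∧
    Tendsto (fun n : ℕ => hankelDet μ (n + 2) / hankelDet μ (n + 1)) atTop (𝓝 l)

/-- The families `dρ(λ, t)`, `t ∈ [0, T)`, which evolve by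
`dρ(λ, t) = e^{λ² t} dρ(λ, 0) / ∫ e^{λ² t} dρ(λ, 0)` and are admissible at all times. -/
def AdmissibleFamilies (T : EReal) (hT : 0 < T) : Set (timeInterval T → Measure ℝ) :=
  {ρ | (∀ t : timeInterval T, ρ t = (ρ (initialTime hT)).withDensity (fun x => ENNReal.ofReal
          (Real.exp (x ^ 2 * t) / ∫ y, Real.exp (y ^ 2 * t) ∂(ρ (initialTime hT))))) ∧
    ∀ t, IsAdmissible (ρ t)}

end

/-! At a fixed time everything is read off from the numbers `powerCoeff a k 0`, which are both the
diagonal entries (L^k e₀, e₀) and the moments of the spectral measure. The Gram factorization of the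
Hankel matrix (`seqHankelDet_powerCoeff`) shows that Δ_{n+1}/Δ_n is the product a_0 ⋯ a_n. Hence the
a_n are recovered from the Hankel determinants, and finiteness of the logarithmic Hamiltonian is
exactly the limit condition on Δ_{n+1}/Δ_n (`hasFiniteLogHamiltonian_iff`).

Either condition forces a_n → 1, so L is bounded and asymptotically the free Jacobi matrix. The two
halves of Weyl's theorem are proved by hand: truncated plane waves put [-2, 2] into the support
(`Icc_subset_support`), and a dimension count leaves only finitely many support points beyond 2 + δ
(`finite_support_outside`). Conversely, an admissible measure has the same moments as the compactly
supported spectral measure built from its Hankel coefficients. Such a moment problem is determinate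
(`measure_ext_of_moments`), so the two measures agree.

In time, the Volterra equations amount to s_k' = s_{k+2} - s_2 s_k, which the normalized measures
e^{x²t} dρ also satisfy. From measures to lattices, the a_n and their equations are recovered
recursively (`hasDerivWithinAt_of_powerCoeff`). From lattices to measures, an integrating factor
turns the even moments into nonnegative functions with f_k' = f_{k+1}. These are absolutely
monotone, and Bernstein's theorem makes them unique given their values at 0
(`eq_of_absolutelyMonotone`), without any bound on a_n uniform in time. -/

noncomputable section

/-! ### The coefficients of the powers of a Jacobi matrix -/

/-- The coefficients `c_{k,j}` of `x^k = ∑ c_{k,j} P_j`, where `P_j` are the monic polynomials with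
`x P_j = P_{j+1} + a_{j-1} P_{j-1}`. -/
def powerCoeff (a : ℕ → ℝ) : ℕ → ℕ → ℝ
  | 0, j => if j = 0 then 1 else 0
  | k + 1, 0 => a 0 * powerCoeff a k 1
  | k + 1, j + 1 => powerCoeff a k j + a (j + 1) * powerCoeff a k (j + 2)

/-- The squared norm `∏_{i < j} a_i` of the `j`-th monic orthogonal polynomial. -/
def normSqProd (a : ℕ → ℝ) (j : ℕ) : ℝ := ∏ i ∈ Finset.range j, a i

variable {a : ℕ → ℝ}

lemma powerCoeff_of_lt {k : ℕ} : ∀ {j : ℕ}, k < j → powerCoeff a k j = 0 := by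
  induction k with
  | zero => intro j hj; simp [powerCoeff, hj.ne']
  | succ k ih =>
    intro j hj
    obtain ⟨j, rfl⟩ : ∃ i, j = i + 1 := ⟨j - 1, by omega⟩
    simp [powerCoeff, ih (show k < j by omega), ih (show k < j + 2 by omega)]

lemma powerCoeff_self (k : ℕ) : powerCoeff a k k = 1 := by
  induction k with
  | zero => simp [powerCoeff]
  | succ k ih => simp [powerCoeff, ih, powerCoeff_of_lt (show k < k + 2 by omega)]

lemma powerCoeff_of_odd {k : ℕ} : ∀ {j : ℕ}, Odd (k + j) → powerCoeff a k j = 0 := by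
  induction k with
  | zero => rintro (_ | j) hj <;> simp [powerCoeff] at hj ⊢
  | succ k ih =>
    rintro (_ | j) hj
    · rw [powerCoeff, ih (by simpa using hj), mul_zero]
    · rw [powerCoeff, ih (by grind), ih (by grind), mul_zero, add_zero]

lemma powerCoeff_nonneg (ha : ∀ n, 0 ≤ a n) (k : ℕ) : ∀ j, 0 ≤ powerCoeff a k j := by
  induction k with
  | zero => intro j; simp only [powerCoeff]; split_ifs <;> simp
  | succ k ih =>
    rintro (_ | j)
    · exact mul_nonneg (ha _) (ih _)
    · exact add_nonneg (ih _) (mul_nonneg (ha _) (ih _))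

lemma powerCoeff_two_zero : powerCoeff a 2 0 = a 0 := by
  simp [powerCoeff]

lemma powerCoeff_add_two_zero (k : ℕ) :
    powerCoeff a (k + 2) 0 = a 0 * powerCoeff a k 0 + a 0 * a 1 * powerCoeff a k 2 := by
  simp [powerCoeff]; ring

lemma normSqProd_succ (j : ℕ) : normSqProd a (j + 1) = normSqProd a j * a j := by
  simp [normSqProd, Finset.prod_range_succ]

lemma normSqProd_pos (ha : ∀ n, 0 < a n) (j : ℕ) : 0 < normSqProd a j :=
  Finset.prod_pos fun i _ => ha i

/-- Multiplication by x is symmetric for the weights `normSqProd a`: the right side is symmetric in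
`i` and `j`. The hypothesis makes the cut-off at `M` harmless, since x^i has no component on
P_{M+1}. -/
lemma sum_powerCoeff_succ_mul {i j M : ℕ} (hi : i < M + 1) :
    ∑ n ∈ Finset.range (M + 1), powerCoeff a (i + 1) n * normSqProd a n * powerCoeff a j n =
      ∑ n ∈ Finset.range M, (powerCoeff a i n * powerCoeff a j (n + 1) +
        powerCoeff a i (n + 1) * powerCoeff a j n) * normSqProd a (n + 1) := by
  have h : ∑ n ∈ Finset.range (M + 1), powerCoeff a i (n + 1) * powerCoeff a j n *
      normSqProd a (n + 1) = ∑ n ∈ Finset.range M, powerCoeff a i (n + 1) * powerCoeff a j n *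
      normSqProd a (n + 1) := by
    rw [Finset.sum_range_succ, powerCoeff_of_lt hi]; ring
  simp only [add_mul, Finset.sum_add_distrib]
  rw [← h, Finset.sum_range_succ', Finset.sum_range_succ' (fun n =>
    powerCoeff a i (n + 1) * powerCoeff a j n * normSqProd a (n + 1)), ← add_assoc,
    ← Finset.sum_add_distrib]
  congr 1
  · refine Finset.sum_congr rfl fun n _ => ?_
    rw [normSqProd_succ (n + 1)]; simp only [powerCoeff]; ring
  · rw [normSqProd_succ 0]; simp only [powerCoeff]; ring

/-- By symmetry the factors x can be moved one at a time from x^i to x^j, until the first entry is 1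
= P_0 and only the term `n = 0` survives. -/
lemma powerCoeff_gram (M : ℕ) : ∀ i j, i + j < M + 1 →
    ∑ n ∈ Finset.range (M + 1), powerCoeff a i n * normSqProd a n * powerCoeff a j n =
      powerCoeff a (i + j) 0 := by
  intro i
  induction i with
  | zero =>
    intro j _
    rw [Finset.sum_range_succ', Finset.sum_eq_zero]
    · simp [powerCoeff, normSqProd]
    · intro n _; simp [powerCoeff]
  | succ i ih =>
    intro j hij
    rw [show i + 1 + j = i + (j + 1) by ring, ← ih (j + 1) (by omega),
      sum_powerCoeff_succ_mul (by omega)]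
    have h := sum_powerCoeff_succ_mul (a := a) (i := j) (j := i) (M := M) (by omega)
    calc _ = _ := Finset.sum_congr rfl fun n _ => by ring
      _ = _ := h.symm
      _ = _ := Finset.sum_congr rfl fun n _ => by ring

/-! ### Hankel determinants -/

/-- The Hankel determinant of size `k × k` of a sequence. -/
def seqHankelDet (s : ℕ → ℝ) (k : ℕ) : ℝ :=
  (Matrix.of fun i j : Fin k => s ((i : ℕ) + (j : ℕ))).det

lemma hankelDet_eq_seqHankelDet (μ : Measure ℝ) (k : ℕ) :
    hankelDet μ k = seqHankelDet (momentOf μ) k := rfl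

/-- The Hankel matrix is C D Cᵀ, where C is lower triangular with unit diagonal and D carries the
squared norms of the monic orthogonal polynomials. -/
lemma seqHankelDet_powerCoeff (k : ℕ) :
    seqHankelDet (fun i => powerCoeff a i 0) k = ∏ n ∈ Finset.range k, normSqProd a n := by
  set C : Matrix (Fin k) (Fin k) ℝ := Matrix.of fun i n => powerCoeff a i n with hC
  have hdet : C.det = 1 := by
    rw [Matrix.det_of_isLowerTriangular]
    · simp [hC, powerCoeff_self]
    · intro i j hij
      exact powerCoeff_of_lt hij
  have hH : (Matrix.of fun i j : Fin k => powerCoeff a ((i : ℕ) + (j : ℕ)) 0) =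
      C * Matrix.diagonal (fun n : Fin k => normSqProd a n) * C.transpose := by
    ext i j
    rw [Matrix.mul_apply, Matrix.of_apply, ← powerCoeff_gram (k + k) i j (by omega)]
    simp only [Matrix.mul_diagonal, Matrix.transpose_apply, hC, Matrix.of_apply]
    rw [Fin.sum_univ_eq_sum_range (fun n => powerCoeff a i n * normSqProd a n * powerCoeff a j n)]
    symm
    refine Finset.sum_subset (by intro x; simp; omega) fun n _ hn => ?_
    rw [powerCoeff_of_lt (show (i : ℕ) < n by simp at hn; omega)]; ring
  rw [seqHankelDet, hH, Matrix.det_mul, Matrix.det_mul, Matrix.det_transpose, hdet,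
    Matrix.det_diagonal, ← Fin.prod_univ_eq_prod_range]
  ring

lemma seqHankelDet_powerCoeff_succ (k : ℕ) :
    seqHankelDet (fun i => powerCoeff a i 0) (k + 1) =
      seqHankelDet (fun i => powerCoeff a i 0) k * normSqProd a k := by
  rw [seqHankelDet_powerCoeff, seqHankelDet_powerCoeff, Finset.prod_range_succ]

lemma seqHankelDet_powerCoeff_pos (ha : ∀ n, 0 < a n) (k : ℕ) :
    0 < seqHankelDet (fun i => powerCoeff a i 0) k := by
  rw [seqHankelDet_powerCoeff]
  exact Finset.prod_pos fun n _ => normSqProd_pos ha n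

/-- The entry of index `2 * n` occurs only in the corner, with the previous determinant as cofactor.
So when that determinant is nonzero, each new Hankel determinant fixes one further even moment. -/
lemma seqHankelDet_congr_corner {s s' : ℕ → ℝ} {n : ℕ} (h : ∀ i < 2 * n, s i = s' i) :
    seqHankelDet s (n + 1) - seqHankelDet s' (n + 1) =
      (s (2 * n) - s' (2 * n)) * seqHankelDet s n := by
  have expand : ∀ u : ℕ → ℝ, seqHankelDet u (n + 1) = ∑ j : Fin (n + 1),
      (-1) ^ (n + (j : ℕ)) * u (n + j) * (Matrix.of fun (i k : Fin n) =>
        u ((i : ℕ) + (j.succAbove k : Fin (n + 1)))).det := by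
    intro u
    rw [seqHankelDet, Matrix.det_succ_row _ (Fin.last n)]
    refine Finset.sum_congr rfl fun j _ => ?_
    congr 2
    ext i k
    simp [Fin.succAbove_last]
  have minor : ∀ u : ℕ → ℝ, (Matrix.of fun (i k : Fin n) =>
        u ((i : ℕ) + ((Fin.last n).succAbove k : Fin (n + 1)))).det = seqHankelDet u n := by
    intro u
    simp [Fin.succAbove_last, seqHankelDet]
  have same : ∀ j : Fin (n + 1), (Matrix.of fun (i k : Fin n) =>
        s ((i : ℕ) + (j.succAbove k : Fin (n + 1)))) = Matrix.of fun (i k : Fin n) =>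
        s' ((i : ℕ) + (j.succAbove k : Fin (n + 1))) := by
    intro j
    ext i k
    exact h _ (by omega)
  rw [expand s, expand s', ← Finset.sum_sub_distrib, Fin.sum_univ_castSucc, Finset.sum_eq_zero]
  · rw [← minor s, ← same]
    simp only [Fin.val_last, zero_add]
    rw [← two_mul, pow_mul]
    ring_nf
  · intro j _
    rw [← same, h _ (by simp; omega)]
    ring

/-- The ratio `Δ_{n+1} Δ_{n-1} / Δ_n²` for a sequence. -/
def seqHankelCoeff (s : ℕ → ℝ) (n : ℕ) : ℝ :=
  seqHankelDet s (n + 2) * seqHankelDet s n / seqHankelDet s (n + 1) ^ 2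

lemma seqHankelCoeff_powerCoeff (ha : ∀ n, 0 < a n) (n : ℕ) :
    seqHankelCoeff (fun i => powerCoeff a i 0) n = a n := by
  have h1 := (seqHankelDet_powerCoeff_pos ha n).ne'
  have h2 := (normSqProd_pos ha n).ne'
  rw [seqHankelCoeff, seqHankelDet_powerCoeff_succ (n + 1), seqHankelDet_powerCoeff_succ n,
    normSqProd_succ]
  field_simp

lemma seqHankelDet_zero (s : ℕ → ℝ) : seqHankelDet s 0 = 1 := by simp [seqHankelDet]

lemma seqHankelDet_one (s : ℕ → ℝ) : seqHankelDet s 1 = s 0 := by simp [seqHankelDet]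

/-- An even normalized sequence with positive Hankel determinants is the moment sequence of the
Jacobi matrix built from its Hankel coefficients. -/
lemma powerCoeff_seqHankelCoeff {s : ℕ → ℝ} (h0 : s 0 = 1) (hodd : ∀ k, Odd k → s k = 0)
    (hpos : ∀ n, 0 < seqHankelDet s n) (k : ℕ) :
    powerCoeff (seqHankelCoeff s) k 0 = s k := by
  have ha : ∀ n, 0 < seqHankelCoeff s n := fun n =>
    div_pos (mul_pos (hpos _) (hpos _)) (pow_pos (hpos _) 2)
  set s' : ℕ → ℝ := fun i => powerCoeff (seqHankelCoeff s) i 0 with hs'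
  have hpos' : ∀ n, 0 < seqHankelDet s' n := seqHankelDet_powerCoeff_pos ha
  -- The coefficients give a two-step recursion for the determinants, so consecutive pairs are
  -- carried along.
  have hdet : ∀ n, seqHankelDet s' n = seqHankelDet s n ∧
      seqHankelDet s' (n + 1) = seqHankelDet s (n + 1) := by
    intro n
    induction n with
    | zero => simp [seqHankelDet_zero, seqHankelDet_one, h0, hs', powerCoeff]
    | succ n ih =>
      refine ⟨ih.2, ?_⟩
      have h := seqHankelCoeff_powerCoeff ha n
      rw [← hs', seqHankelCoeff, seqHankelCoeff, ih.1, ih.2] at h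
      have h1 := (hpos n).ne'
      have h2 := (hpos (n + 1)).ne'
      field_simp at h
      exact h
  induction k using Nat.strong_induction_on with
  | _ k ih =>
    rcases Nat.even_or_odd' k with ⟨n, rfl | rfl⟩
    · have h := seqHankelDet_congr_corner (s := s') (s' := s) (n := n) fun i hi => ih i hi
      rw [(hdet n).2, sub_self, eq_comm, mul_eq_zero] at h
      exact sub_eq_zero.1 (h.resolve_right (hpos' n).ne')
    · rw [hodd _ ⟨n, rfl⟩, powerCoeff_of_odd ⟨n, by ring⟩]

/-! ### The Volterra flow on the coefficients -/

lemma leftNeighbour_succ (a : ℕ → ℝ) (n : ℕ) : leftNeighbour a (n + 1) = a n := by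
  simp [leftNeighbour]

lemma leftNeighbour_zero (a : ℕ → ℝ) : leftNeighbour a 0 = 0 := by
  simp [leftNeighbour]

/-- This is dual to P_{j+2}' = -a_j a_{j+1} P_j. For `j = 0`, `powerCoeff_add_two_zero` turns it
into the moment equation s_k' = s_{k+2} - s_2 s_k. -/
lemma hasDerivWithinAt_powerCoeff {A : ℝ → ℕ → ℝ} {S : Set ℝ} {t : ℝ}
    (hA : ∀ n, HasDerivWithinAt (fun x => A x n)
      (A t n * (A t (n + 1) - leftNeighbour (A t) n)) S t) (k : ℕ) :
    ∀ j, HasDerivWithinAt (fun x => powerCoeff (A x) k j)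
      (A t j * A t (j + 1) * powerCoeff (A t) k (j + 2)) S t := by
  induction k with
  | zero =>
    intro j
    simpa [powerCoeff] using hasDerivWithinAt_const t S (if j = 0 then (1 : ℝ) else 0)
  | succ k ih =>
    rintro (_ | j)
    · simp only [powerCoeff]
      refine ((hA 0).mul (ih 1)).congr_deriv ?_
      rw [leftNeighbour_zero]; ring
    · simp only [powerCoeff]
      refine ((ih j).add ((hA (j + 1)).mul (ih (j + 2)))).congr_deriv ?_
      rw [leftNeighbour_succ]; ring

/-- The moment equations `s_k' = s_{k+2} - s_2 s_k` imply the Volterra equations. -/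
lemma hasDerivWithinAt_of_powerCoeff {A : ℝ → ℕ → ℝ} {S : Set ℝ} {t : ℝ} (ht : t ∈ S)
    (hpos : ∀ x ∈ S, ∀ n, 0 < A x n)
    (hs : ∀ k, HasDerivWithinAt (fun x => powerCoeff (A x) k 0)
      (powerCoeff (A t) (k + 2) 0 - powerCoeff (A t) 2 0 * powerCoeff (A t) k 0) S t) (n : ℕ) :
    HasDerivWithinAt (fun x => A x n)
      (A t n * (A t (n + 1) - leftNeighbour (A t) n)) S t := by
  -- Column `j + 1` is the quotient (c_{k+1,j} - c_{k,j-1}) / a_j. The third hypothesis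
  -- differentiates c_{k,j-1}, written as a difference so that it also covers `j = 0`, where this
  -- term is 0.
  have key : ∀ j, (∀ k, HasDerivWithinAt (fun x => powerCoeff (A x) k j)
      (A t j * A t (j + 1) * powerCoeff (A t) k (j + 2)) S t) →
      HasDerivWithinAt (fun x => A x j) (A t j * (A t (j + 1) - leftNeighbour (A t) j)) S t →
      (∀ k, HasDerivWithinAt (fun x => powerCoeff (A x) (k + 1) j - A x j *
        powerCoeff (A x) k (j + 1)) (A t j * A t (j + 1) * powerCoeff (A t) (k + 1) (j + 2)
          - A t j * (A t (j + 1) * powerCoeff (A t) k (j + 1) + A t (j + 1) * A t (j + 2) *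
          powerCoeff (A t) k (j + 3)) + A t j * leftNeighbour (A t) j *
          powerCoeff (A t) k (j + 1)) S t) →
      ∀ k, HasDerivWithinAt (fun x => powerCoeff (A x) k (j + 1))
      (A t (j + 1) * A t (j + 2) * powerCoeff (A t) k (j + 3)) S t := by
    intro j h1 h2 h3 k
    have hne := (hpos t ht j).ne'
    have h := ((h1 (k + 1)).sub (h3 k)).div h2 hne
    refine (h.congr_of_mem (fun x hx => ?_) ht).congr_deriv ?_
    · have := (hpos x hx j).ne'
      simp only [Pi.sub_apply, Pi.div_apply]
      field_simp
      ring
    · simp only [Pi.sub_apply]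
      field_simp
      ring
  have main : ∀ j, (∀ k, HasDerivWithinAt (fun x => powerCoeff (A x) k j)
      (A t j * A t (j + 1) * powerCoeff (A t) k (j + 2)) S t) ∧
      (∀ k, HasDerivWithinAt (fun x => powerCoeff (A x) k (j + 1))
      (A t (j + 1) * A t (j + 2) * powerCoeff (A t) k (j + 3)) S t) ∧
      HasDerivWithinAt (fun x => A x j) (A t j * (A t (j + 1) - leftNeighbour (A t) j)) S t := by
    intro j
    induction j with
    | zero =>
      have h0 : ∀ k, HasDerivWithinAt (fun x => powerCoeff (A x) k 0)
          (A t 0 * A t (0 + 1) * powerCoeff (A t) k (0 + 2)) S t := fun k =>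
        (hs k).congr_deriv (by rw [powerCoeff_add_two_zero, powerCoeff_two_zero]; ring)
      have h1 : HasDerivWithinAt (fun x => A x 0)
          (A t 0 * (A t (0 + 1) - leftNeighbour (A t) 0)) S t := by
        refine ((h0 2).congr_of_mem (fun x _ => powerCoeff_two_zero.symm) ht).congr_deriv ?_
        rw [leftNeighbour_zero, powerCoeff_self]; ring
      refine ⟨h0, key 0 h0 h1 fun k => ?_, h1⟩
      refine ((hasDerivWithinAt_const t S (0 : ℝ)).congr_of_mem (fun x _ => ?_) ht).congr_deriv ?_
      · simp [powerCoeff]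
      · rw [leftNeighbour_zero]; simp [powerCoeff]; ring
    | succ j ih =>
      obtain ⟨h0, h1, h2⟩ := ih
      -- Since c_{k,k} = 1, the recursion gives a_{j+1} = c_{j+3,j+1} - c_{j+2,j}, and both columns
      -- are already differentiated.
      have h3 : HasDerivWithinAt (fun x => A x (j + 1))
          (A t (j + 1) * (A t (j + 1 + 1) - leftNeighbour (A t) (j + 1))) S t := by
        refine (((h1 (j + 3)).sub (h0 (j + 2))).congr_of_mem (fun x _ => ?_) ht).congr_deriv ?_
        · have h : powerCoeff (A x) (j + 3) (j + 1) = powerCoeff (A x) (j + 2) j +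
              A x (j + 1) * powerCoeff (A x) (j + 2) (j + 2) := rfl
          rw [Pi.sub_apply, h, powerCoeff_self]; ring
        · rw [leftNeighbour_succ, powerCoeff_self, powerCoeff_self]; ring
      refine ⟨h1, key (j + 1) h1 h3 fun k => ?_, h3⟩
      refine ((h0 k).congr_of_mem (fun x _ => ?_) ht).congr_deriv ?_
      · simp [powerCoeff]
      · rw [leftNeighbour_succ]; simp [powerCoeff]; ring
  exact (main n).2.2

end

noncomputable section

/-! ### Weighted shifts and Jacobi operators -/

lemma SeqSpace.summable_norm_sq (v : SeqSpace) : Summable fun n => ‖v n‖ ^ 2 := by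
  have := (lp.memℓp v).summable (by simp)
  simpa using this

lemma SeqSpace.norm_sq_eq_tsum (v : SeqSpace) : ‖v‖ ^ 2 = ∑' n, ‖v n‖ ^ 2 := by
  have := lp.norm_rpow_eq_tsum (p := 2) (by simp) v
  simpa using this

lemma summable_weighted_succ {b : ℕ → ℝ} {C : ℝ} (hb : ∀ n, |b n| ≤ C) (v : SeqSpace) :
    Summable fun n => ‖(b n : ℂ) * v (n + 1)‖ ^ 2 := by
  refine Summable.of_nonneg_of_le (fun n => by positivity) (fun n => ?_)
    (((summable_nat_add_iff 1).2 v.summable_norm_sq).mul_left (C ^ 2))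
  rw [norm_mul, mul_pow, Complex.norm_real, Real.norm_eq_abs]
  gcongr
  exact hb n

/-- The weighted backward shift `(W v)_n = b_n v_{n+1}`. -/
def weightedShift (b : ℕ → ℝ) (C : ℝ) (hb : ∀ n, |b n| ≤ C) : SeqSpace →L[ℂ] SeqSpace :=
  LinearMap.mkContinuous
    { toFun := fun v => ⟨fun n => (b n : ℂ) * v (n + 1),
        memℓp_gen (by simpa using summable_weighted_succ hb v)⟩
      map_add' := fun v w => by ext n; exact mul_add _ _ _
      map_smul' := fun c v => by ext n; simp [mul_left_comm] }
    C (fun v => by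
      have hC : 0 ≤ C := (abs_nonneg _).trans (hb 0)
      refine abs_le_of_sq_le_sq' ?_ (by positivity) |>.2
      rw [mul_pow, SeqSpace.norm_sq_eq_tsum, SeqSpace.norm_sq_eq_tsum v,
        v.summable_norm_sq.tsum_eq_zero_add, mul_add, ← tsum_mul_left]
      refine le_trans ?_ (le_add_of_nonneg_left (by positivity))
      refine (summable_weighted_succ hb v).tsum_le_tsum (fun n => ?_)
        (((summable_nat_add_iff 1).2 v.summable_norm_sq).mul_left (C ^ 2))
      change ‖(b n : ℂ) * v (n + 1)‖ ^ 2 ≤ C ^ 2 * ‖v (n + 1)‖ ^ 2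
      rw [norm_mul, mul_pow, Complex.norm_real, Real.norm_eq_abs]
      gcongr
      exact hb n)

/-- The Jacobi operator with zero diagonal and off-diagonal entries `b_n`. -/
def jacobiOp (b : ℕ → ℝ) (C : ℝ) (hb : ∀ n, |b n| ≤ C) : SeqSpace →L[ℂ] SeqSpace :=
  weightedShift b C hb + (weightedShift b C hb).adjoint

variable {b : ℕ → ℝ} {C : ℝ} {hb : ∀ n, |b n| ≤ C}

lemma weightedShift_apply (v : SeqSpace) (n : ℕ) :
    weightedShift b C hb v n = (b n : ℂ) * v (n + 1) := rfl

lemma stdVec_apply (i j : ℕ) : stdVec i j = if j = i then 1 else 0 := by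
  simp [stdVec, lp.single_apply, Pi.single_apply]

lemma inner_stdVec_left (n : ℕ) (v : SeqSpace) : inner ℂ (stdVec n) v = v n := by
  rw [stdVec, lp.inner_single_left]; simp

lemma weightedShift_stdVec_zero : weightedShift b C hb (stdVec 0) = 0 := by
  ext n; simp [weightedShift_apply, stdVec_apply]

lemma weightedShift_stdVec_succ (i : ℕ) :
    weightedShift b C hb (stdVec (i + 1)) = (b i : ℂ) • stdVec i := by
  ext n
  simp only [weightedShift_apply, stdVec_apply, lp.coeFn_smul, Pi.smul_apply, smul_eq_mul,
    Nat.add_right_cancel_iff]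
  split_ifs with h <;> simp [h]

lemma jacobiOp_apply_zero (v : SeqSpace) : jacobiOp b C hb v 0 = (b 0 : ℂ) * v 1 := by
  have h : (weightedShift b C hb).adjoint v 0 = 0 := by
    rw [← inner_stdVec_left, ContinuousLinearMap.adjoint_inner_right, weightedShift_stdVec_zero,
      inner_zero_left]
  rw [jacobiOp, add_apply, lp.coeFn_add, Pi.add_apply, h, add_zero,
    weightedShift_apply]

lemma jacobiOp_apply_succ (v : SeqSpace) (n : ℕ) :
    jacobiOp b C hb v (n + 1) = (b (n + 1) : ℂ) * v (n + 2) + (b n : ℂ) * v n := by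
  have h : (weightedShift b C hb).adjoint v (n + 1) = (b n : ℂ) * v n := by
    rw [← inner_stdVec_left, ContinuousLinearMap.adjoint_inner_right, weightedShift_stdVec_succ,
      inner_smul_left, inner_stdVec_left, Complex.conj_ofReal]
  rw [jacobiOp, add_apply, lp.coeFn_add, Pi.add_apply, h,
    weightedShift_apply]

lemma isSelfAdjoint_jacobiOp : IsSelfAdjoint (jacobiOp b C hb) := by
  rw [jacobiOp, ← ContinuousLinearMap.star_eq_adjoint]
  exact IsSelfAdjoint.add_star_self _

lemma norm_jacobiOp_apply_le (v : SeqSpace) : ‖jacobiOp b C hb v‖ ≤ 2 * C * ‖v‖ := by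
  have hC : 0 ≤ C := (abs_nonneg _).trans (hb 0)
  have h1 : ‖weightedShift b C hb‖ ≤ C := LinearMap.mkContinuous_norm_le _ hC _
  have h2 : ‖jacobiOp b C hb‖ ≤ 2 * C := by
    refine (norm_add_le _ _).trans ?_
    rw [LinearIsometryEquiv.norm_map]
    linarith
  exact ContinuousLinearMap.le_of_opNorm_le _ h2 v

lemma jacobiOp_stdVec_zero : jacobiOp b C hb (stdVec 0) = (b 0 : ℂ) • stdVec 1 := by
  ext n
  rcases n with _ | n
  · rw [jacobiOp_apply_zero, lp.coeFn_smul, Pi.smul_apply, stdVec_apply, stdVec_apply]; simp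
  · simp only [jacobiOp_apply_succ, stdVec_apply, lp.coeFn_smul, Pi.smul_apply, smul_eq_mul]
    rcases n with _ | n <;> simp

lemma jacobiOp_stdVec_succ (i : ℕ) : jacobiOp b C hb (stdVec (i + 1)) =
    (b (i + 1) : ℂ) • stdVec (i + 2) + (b i : ℂ) • stdVec i := by
  ext n
  rcases n with _ | n
  · simp only [jacobiOp_apply_zero, stdVec_apply, lp.coeFn_smul, lp.coeFn_add, Pi.smul_apply,
      Pi.add_apply, smul_eq_mul]
    rcases i with _ | i <;> simp
  · simp only [jacobiOp_apply_succ, stdVec_apply, lp.coeFn_smul, lp.coeFn_add, Pi.smul_apply,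
      Pi.add_apply, smul_eq_mul]
    grind

lemma isLaxOperator_jacobiOp {a : ℕ → ℝ} {C : ℝ} (hb : ∀ n, |√(a n)| ≤ C) :
    IsLaxOperator a (jacobiOp (fun n => √(a n)) C hb) := by
  refine ⟨isSelfAdjoint_jacobiOp, fun i j => ?_⟩
  rw [inner_stdVec_left, laxMatrix]
  rcases i with _ | i
  · simp only [jacobiOp_apply_zero, stdVec_apply]
    rcases j with _ | j
    · simp
    · rcases j with _ | j <;> simp
  · simp only [jacobiOp_apply_succ, stdVec_apply, Nat.add_right_cancel_iff]
    rw [show i + 1 + 1 = i + 2 from rfl]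
    split_ifs with h1 h2 h3 h4 h5 h6 h7 <;> first | omega | simp_all

/-- The powers of the Lax operator at the first basis vector. -/
lemma jacobiOp_pow_stdVec {a : ℕ → ℝ} (ha : ∀ n, 0 < a n) {C : ℝ} (hb : ∀ n, |√(a n)| ≤ C)
    (k : ℕ) : ∀ j, ((jacobiOp (fun n => √(a n)) C hb) ^ k) (stdVec 0) j =
      ((powerCoeff a k j * √(normSqProd a j) : ℝ) : ℂ) := by
  have hs : ∀ j, √(normSqProd a (j + 1)) = √(normSqProd a j) * √(a j) := fun j => by
    rw [normSqProd_succ, Real.sqrt_mul (normSqProd_pos ha j).le]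
  have hm : ∀ j, √(a j) * √(a j) = a j := fun j => Real.mul_self_sqrt (ha j).le
  induction k with
  | zero =>
    intro j
    rcases j with _ | j <;> simp [stdVec_apply, powerCoeff, normSqProd]
  | succ k ih =>
    intro j
    rw [pow_succ', mul_apply_eq_comp]
    rcases j with _ | j
    · rw [jacobiOp_apply_zero, ih, ← Complex.ofReal_mul]
      congr 1
      rw [hs]; simp only [powerCoeff]
      linear_combination (powerCoeff a k 1 * √(normSqProd a 0)) * hm 0
    · rw [jacobiOp_apply_succ, ih, ih, ← Complex.ofReal_mul, ← Complex.ofReal_mul,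
        ← Complex.ofReal_add]
      congr 1
      rw [hs (j + 1), hs j]; simp only [powerCoeff]
      linear_combination (powerCoeff a k (j + 2) * √(normSqProd a j) * √(a j)) * hm (j + 1)

/-! ### Spectral measures of bounded self-adjoint operators -/

section SpectralMeasure

variable {H : Type*} [NormedAddCommGroup H] [InnerProductSpace ℂ H] [CompleteSpace H]

/-- `μ` is the compactly supported measure representing `f ↦ (f(L) v, v)` on all continuous
functions. -/
structure RepresentsSpectralMeasure (L : H →L[ℂ] H) (v : H) (μ : Measure ℝ) : Prop where
  selfAdjoint : IsSelfAdjoint L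
  finite : IsFiniteMeasure μ
  bounded : ∃ R : ℝ, μ (Icc (-R) R)ᶜ = 0
  integral : ∀ f : ℝ → ℝ, Continuous f →
    ((∫ x, f x ∂μ : ℝ) : ℂ) = inner ℂ v (cfc f L v)

lemma re_inner_cfcHom_nonneg {L : H →L[ℂ] H} (hL : IsSelfAdjoint L) (v : H)
    {f : C(spectrum ℝ L, ℝ)} (hf : 0 ≤ f) : 0 ≤ (inner ℂ v (cfcHom hL f v)).re := by
  have h := (cfcHom_nonneg_iff hL).2 hf
  rw [ContinuousLinearMap.nonneg_iff_isPositive] at h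
  simpa using h.re_inner_nonneg_right v

/-- Riesz–Markov for the positive functional f ↦ Re (f(L) v, v) on the compact spectrum, pushed
forward to the line; (f(L) v, v) is real for real f. -/
lemma exists_representsSpectralMeasure {L : H →L[ℂ] H} (hL : IsSelfAdjoint L) (v : H) :
    ∃ μ : Measure ℝ, RepresentsSpectralMeasure L v μ := by
  have : CompactSpace (spectrum ℝ L) := isCompact_iff_compactSpace.1 (spectrum.isCompact L)
  let Λ : CompactlySupportedContinuousMap (spectrum ℝ L) ℝ →ₚ[ℝ] ℝ := PositiveLinearMap.mk₀
    { toFun := fun f => (inner ℂ v (cfcHom hL f.toContinuousMap v)).re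
      map_add' := fun f g => by
        have : (f + g).toContinuousMap = f.toContinuousMap + g.toContinuousMap := rfl
        rw [this, map_add, add_apply, inner_add_right, Complex.add_re]
      map_smul' := fun c f => by
        have : (c • f).toContinuousMap = c • f.toContinuousMap := rfl
        rw [this, map_smul, smul_apply, inner_smul_right_eq_smul]
        simp }
    (fun f hf => re_inner_cfcHom_nonneg hL v hf)
  set m := RealRMK.rieszMeasure Λ with hm
  have : IsFiniteMeasure m := ⟨isCompact_univ.measure_lt_top⟩
  have hval : Measurable (Subtype.val : spectrum ℝ L → ℝ) := measurable_subtype_coe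
  refine ⟨m.map Subtype.val, hL, inferInstance, ?_, fun f hf => ?_⟩
  · obtain ⟨R, hR⟩ := (spectrum.isCompact (𝕜 := ℝ) L).isBounded.subset_closedBall 0
    refine ⟨R, ?_⟩
    rw [Measure.map_apply hval measurableSet_Icc.compl]
    convert measure_empty (μ := m)
    ext ⟨x, hx⟩
    have := hR hx
    rw [Real.closedBall_eq_Icc] at this
    simpa using this
  · rw [integral_map hval.aemeasurable hf.aestronglyMeasurable]
    have h := RealRMK.integral_rieszMeasure Λ
      (CompactlySupportedContinuousMap.continuousMapEquiv
        ⟨fun x : spectrum ℝ L => f x, hf.comp continuous_subtype_val⟩)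
    have h2 : cfc f L = cfcHom hL ⟨fun x : spectrum ℝ L => f x, hf.comp continuous_subtype_val⟩ :=
      cfc_apply f L hL hf.continuousOn
    have h3 : (∫ x : spectrum ℝ L, f x ∂m) = (inner ℂ v (cfc f L v)).re := by
      rw [h2]; exact h
    rw [h3]
    exact ((IsSelfAdjoint.cfc (f := f) (a := L)).isSymmetric.coe_re_inner_self_apply v)

variable {L : H →L[ℂ] H} {v : H} {μ : Measure ℝ}

lemma RepresentsSpectralMeasure.isSpectralMeasureAt (h : RepresentsSpectralMeasure L v μ) :
    IsSpectralMeasureAt L v μ :=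
  ⟨h.selfAdjoint, h.finite, fun f => h.integral _ f.continuous⟩

lemma RepresentsSpectralMeasure.integral_sq (h : RepresentsSpectralMeasure L v μ) {f : ℝ → ℝ}
    (hf : Continuous f) : ∫ x, f x ^ 2 ∂μ = ‖cfc f L v‖ ^ 2 := by
  have h1 := h.integral (fun x => f x ^ 2) (hf.pow 2)
  have hL := h.selfAdjoint
  have h2 : cfc (fun x => f x ^ 2) L = cfc f L * cfc f L := by
    simp only [sq]; exact cfc_mul f f L hf.continuousOn hf.continuousOn
  rw [h2, mul_apply_eq_comp] at h1
  have h3 := (IsSelfAdjoint.cfc (f := f) (a := L)).isSymmetric v (cfc f L v)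
  simp only [ContinuousLinearMap.coe_coe] at h3
  rw [← h3, inner_self_eq_norm_sq_to_K] at h1
  apply Complex.ofReal_injective
  rw [h1]
  push_cast
  rfl

lemma cfc_id_mul (hL : IsSelfAdjoint L) {f : ℝ → ℝ} (hf : Continuous f) :
    cfc (fun x => x * f x) L = L * cfc f L := by
  rw [cfc_mul (fun x => x) f L continuous_id.continuousOn hf.continuousOn, cfc_id' ℝ L]

lemma RepresentsSpectralMeasure.integral_pow (h : RepresentsSpectralMeasure L v μ) (k : ℕ) :
    ((∫ x, x ^ k ∂μ : ℝ) : ℂ) = inner ℂ v ((L ^ k) v) := by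
  have hL := h.selfAdjoint
  rw [h.integral _ (continuous_pow k), cfc_pow (fun x => x) k L continuous_id.continuousOn,
    cfc_id' ℝ L]

end SpectralMeasure

end

noncomputable section

/-! ### Vectors of the form `f(L) v` -/

lemma integrable_of_continuous_of_compl_Icc {μ : Measure ℝ} [IsFiniteMeasure μ] {R : ℝ}
    (hR : μ (Icc (-R) R)ᶜ = 0) {f : ℝ → ℝ} (hf : Continuous f) : Integrable f μ := by
  have h : μ.restrict (Icc (-R) R) = μ :=
    Measure.restrict_eq_self_of_ae_mem (mem_ae_iff.2 hR)
  rw [← h]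
  exact hf.continuousOn.integrableOn_compact isCompact_Icc

lemma eq_zero_of_mem_support_of_integral_nonpos {μ : Measure ℝ} {g : ℝ → ℝ} (hg : Continuous g)
    (h0 : ∀ x, 0 ≤ g x) (hi : Integrable g μ) (hle : ∫ x, g x ∂μ ≤ 0) {x : ℝ}
    (hx : x ∈ μ.support) : g x = 0 := by
  have h1 : ∫ x, g x ∂μ = 0 := le_antisymm hle (integral_nonneg h0)
  rw [integral_eq_zero_iff_of_nonneg h0 hi] at h1
  by_contra hne
  have h2 : {y | g y ≠ 0} ∈ 𝓝 x := (isOpen_ne_fun hg continuous_const).mem_nhds hne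
  exact ((Measure.mem_support_iff_forall x).1 hx _ h2).ne' h1

section Reachable

variable {H : Type*} [NormedAddCommGroup H] [InnerProductSpace ℂ H] [CompleteSpace H]
  {L : H →L[ℂ] H} {v : H} {μ : Measure ℝ}

/-- `w = f(L) v` for a continuous real function `f`. -/
def IsFunctionOf (L : H →L[ℂ] H) (v w : H) : Prop :=
  ∃ f : ℝ → ℝ, Continuous f ∧ cfc f L v = w

lemma IsFunctionOf.add {w w' : H} (h : IsFunctionOf L v w) (h' : IsFunctionOf L v w') :
    IsFunctionOf L v (w + w') := by
  obtain ⟨f, hf, rfl⟩ := h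
  obtain ⟨g, hg, rfl⟩ := h'
  exact ⟨fun x => f x + g x, hf.add hg, by
    rw [cfc_add (a := L) f g hf.continuousOn hg.continuousOn, add_apply]⟩

lemma IsFunctionOf.smul {w : H} (h : IsFunctionOf L v w) (r : ℝ) :
    IsFunctionOf L v ((r : ℂ) • w) := by
  obtain ⟨f, hf, rfl⟩ := h
  exact ⟨fun x => r * f x, continuous_const.mul hf, by
    rw [cfc_const_mul r f L hf.continuousOn, smul_apply, Complex.coe_smul]⟩

lemma IsFunctionOf.sub {w w' : H} (h : IsFunctionOf L v w) (h' : IsFunctionOf L v w') :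
    IsFunctionOf L v (w - w') := by
  have := h.add (h'.smul (-1))
  simpa [sub_eq_add_neg] using this

lemma IsFunctionOf.apply (hL : IsSelfAdjoint L) {w : H} (h : IsFunctionOf L v w) :
    IsFunctionOf L v (L w) := by
  obtain ⟨f, hf, rfl⟩ := h
  exact ⟨fun x => x * f x, continuous_id.mul hf, by rw [cfc_id_mul hL hf]; rfl⟩

lemma isFunctionOf_self (hL : IsSelfAdjoint L) : IsFunctionOf L v v :=
  ⟨fun _ => 1, continuous_const, by rw [cfc_const_one ℝ L]; rfl⟩

lemma isFunctionOf_zero (hL : IsSelfAdjoint L) : IsFunctionOf L v 0 := by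
  simpa using (isFunctionOf_self hL (v := v)).smul 0

lemma isFunctionOf_sum (hL : IsSelfAdjoint L) {ι : Type*} (s : Finset ι) (w : ι → H)
    (h : ∀ i ∈ s, IsFunctionOf L v (w i)) : IsFunctionOf L v (∑ i ∈ s, w i) :=
  Finset.sum_induction w (IsFunctionOf L v) (fun _ _ => IsFunctionOf.add) (isFunctionOf_zero hL) h

/-- Away from the support of the spectral measure the operator is bounded below. -/
lemma RepresentsSpectralMeasure.norm_sub_smul_ge (h : RepresentsSpectralMeasure L v μ) {x ε : ℝ}
    (hε : 0 < ε) (hx : μ (Metric.ball x ε) = 0) {w : H} (hw : IsFunctionOf L v w) :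
    ε ^ 2 * ‖w‖ ^ 2 ≤ ‖L w - (x : ℂ) • w‖ ^ 2 := by
  have hL := h.selfAdjoint
  have := h.finite
  obtain ⟨R, hR⟩ := h.bounded
  obtain ⟨f, hf, rfl⟩ := hw
  have hg : Continuous fun y => y * f y - x * f y :=
    (continuous_id.mul hf).sub (continuous_const.mul hf)
  have e : cfc (fun y => y * f y - x * f y) L v =
      L (cfc f L v) - (x : ℂ) • cfc f L v := by
    rw [cfc_sub (a := L) (fun y => y * f y) (fun y => x * f y)
      (continuous_id.mul hf).continuousOn (continuous_const.mul hf).continuousOn,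
      cfc_id_mul hL hf, cfc_const_mul x f L hf.continuousOn, sub_apply, smul_apply,
      Complex.coe_smul]
    rfl
  rw [← e, ← h.integral_sq hf, ← h.integral_sq hg, ← integral_const_mul]
  refine integral_mono_ae (integrable_of_continuous_of_compl_Icc hR
    (continuous_const.mul (hf.pow 2))) (integrable_of_continuous_of_compl_Icc hR (hg.pow 2)) ?_
  filter_upwards [measure_eq_zero_iff_ae_notMem.1 hx] with y hy
  rw [Metric.mem_ball, Real.dist_eq, not_lt] at hy
  rw [show y * f y - x * f y = (y - x) * f y by ring, mul_pow, ← sq_abs (y - x)]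
  gcongr

end Reachable

/-! ### The support of the spectral measure of a Jacobi matrix with `b_n → 1` -/

variable {b : ℕ → ℝ} {C : ℝ} {hb : ∀ n, |b n| ≤ C} {μ : Measure ℝ}

lemma isFunctionOf_stdVec (hpos : ∀ n, 0 < b n) (n : ℕ) :
    IsFunctionOf (jacobiOp b C hb) (stdVec 0) (stdVec n) := by
  have hL : IsSelfAdjoint (jacobiOp b C hb) := isSelfAdjoint_jacobiOp
  have hne : ∀ n, (b n : ℂ) ≠ 0 := fun n => by exact_mod_cast (hpos n).ne'
  have h : ∀ n, IsFunctionOf (jacobiOp b C hb) (stdVec 0) (stdVec n) ∧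
      IsFunctionOf (jacobiOp b C hb) (stdVec 0) (stdVec (n + 1)) := by
    intro n
    induction n with
    | zero =>
      refine ⟨isFunctionOf_self hL, ?_⟩
      have h1 := ((isFunctionOf_self hL (v := stdVec 0)).apply hL).smul (b 0)⁻¹
      rwa [jacobiOp_stdVec_zero, smul_smul, Complex.ofReal_inv, inv_mul_cancel₀ (hne 0),
        one_smul] at h1
    | succ n ih =>
      refine ⟨ih.2, ?_⟩
      have h1 := ((ih.2.apply hL).sub (ih.1.smul (b n))).smul (b (n + 1))⁻¹
      rwa [jacobiOp_stdVec_succ, add_sub_cancel_right, smul_smul, Complex.ofReal_inv,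
        inv_mul_cancel₀ (hne _), one_smul] at h1
  exact (h n).1

/-- The finitely supported vector with coordinates `u_n`, `n < M`. -/
def finVec (u : ℕ → ℝ) (M : ℕ) : SeqSpace := ∑ n ∈ Finset.range M, (u n : ℂ) • stdVec n

lemma finVec_apply (u : ℕ → ℝ) {M : ℕ} (hu : ∀ n, M ≤ n → u n = 0) (n : ℕ) :
    finVec u M n = u n := by
  rw [← inner_stdVec_left, finVec, inner_sum]
  simp only [inner_smul_right, inner_stdVec_left, stdVec_apply]
  by_cases h : n < M
  · rw [Finset.sum_eq_single n] <;> grind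
  · rw [Finset.sum_eq_zero, hu n (by omega)]
    · simp
    · intro m hm
      rw [if_neg (by simp at hm; omega), mul_zero]

lemma isFunctionOf_finVec (hpos : ∀ n, 0 < b n) (u : ℕ → ℝ) (M : ℕ) :
    IsFunctionOf (jacobiOp b C hb) (stdVec 0) (finVec u M) :=
  isFunctionOf_sum isSelfAdjoint_jacobiOp _ _ fun n _ => (isFunctionOf_stdVec hpos n).smul _

lemma SeqSpace.norm_sq_eq_sum {v : SeqSpace} {u : ℕ → ℝ} {M : ℕ} (hv : ∀ n, v n = (u n : ℂ))
    (hu : ∀ n, M ≤ n → u n = 0) : ‖v‖ ^ 2 = ∑ n ∈ Finset.range M, u n ^ 2 := by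
  rw [v.norm_sq_eq_tsum, tsum_eq_sum (s := Finset.range M)]
  · exact Finset.sum_congr rfl fun n _ => by rw [hv, Complex.norm_real, Real.norm_eq_abs, sq_abs]
  · intro n hn
    rw [hv, hu n (by simpa using hn)]; simp

/-- Residual estimate for a plane wave cut off to the window `[N, N + K)`. -/
lemma norm_jacobiOp_window_le {x δ : ℝ} {κ : ℕ → ℝ} {N K : ℕ} (hx : |x| ≤ 2)
    (hκ : ∀ n, |κ n| ≤ 1) (hrec : ∀ n, κ (n + 2) + κ n = x * κ (n + 1)) (hN : 2 ≤ N)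
    (hδ : ∀ n, N ≤ n → |b n - 1| ≤ δ)
    {u : ℕ → ℝ} (hu : u = fun n => if n ∈ Finset.Ico N (N + K) then κ n else 0) :
    ‖jacobiOp b C hb (finVec u (N + K)) - (x : ℂ) • finVec u (N + K)‖ ^ 2 ≤
      K * (2 * δ) ^ 2 + 4 * (2 * C + 2) ^ 2 := by
  have hC : 0 ≤ C := (abs_nonneg _).trans (hb 0)
  have hδ0 : 0 ≤ δ := (abs_nonneg _).trans (hδ N le_rfl)
  have hz : ∀ n, n ∉ Finset.Ico N (N + K) → u n = 0 := fun n hn => by rw [hu]; exact if_neg hn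
  have hin : ∀ n, n ∈ Finset.Ico N (N + K) → u n = κ n := fun n hn => by rw [hu]; exact if_pos hn
  have hu1 : ∀ n, |u n| ≤ 1 := fun n => by
    by_cases h : n ∈ Finset.Ico N (N + K)
    · rw [hin n h]; exact hκ n
    · rw [hz n h]; simp
  have hcoord := finVec_apply u (M := N + K) fun n hn => hz n (by simp; omega)
  -- The residual at site 0 vanishes because `2 ≤ N` keeps the window away from sites 0 and 1.
  set r : ℕ → ℝ := fun n =>
    if n = 0 then 0 else b n * u (n + 1) + b (n - 1) * u (n - 1) - x * u n with hr
  have hres : ∀ n, (jacobiOp b C hb (finVec u (N + K)) - (x : ℂ) • finVec u (N + K)) n =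
      (r n : ℂ) := by
    intro n
    rw [lp.coeFn_sub, Pi.sub_apply, lp.coeFn_smul, Pi.smul_apply, hcoord, smul_eq_mul]
    rcases n with _ | n
    · rw [jacobiOp_apply_zero, hcoord, hz 1 (by simp; omega), hz 0 (by simp; omega)]
      simp [hr]
    · rw [jacobiOp_apply_succ, hcoord, hcoord]
      simp [hr]
  have hrz : ∀ n, N + K + 1 ≤ n → r n = 0 := by
    intro n hn
    simp only [hr]
    rw [hz (n + 1) (by simp; omega), hz (n - 1) (by simp; omega), hz n (by simp; omega)]
    simp
  -- Only at these four sites does the cut-off spoil the recurrence; there the crude bound C + C +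
  -- |x| ≤ 2C + 2 suffices.
  set F : Finset ℕ := {N - 1, N, N + K - 1, N + K} with hF
  have hbound : ∀ n, r n ^ 2 ≤ (if n ∈ Finset.Ico N (N + K) then (2 * δ) ^ 2 else 0) +
      (if n ∈ F then (2 * C + 2) ^ 2 else 0) := by
    intro n
    rcases n with _ | n
    · simp only [hr, if_pos]
      rw [zero_pow two_ne_zero]
      exact add_nonneg (by split_ifs <;> positivity) (by split_ifs <;> positivity)
    have hrn : r (n + 1) = b (n + 1) * u (n + 2) + b n * u n - x * u (n + 1) := by simp [hr]
    by_cases h1 : n + 1 ∈ F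
    · rw [if_pos h1]
      have h2 : |r (n + 1)| ≤ 2 * C + 2 := by
        rw [hrn]
        calc _ ≤ |b (n + 1) * u (n + 2)| + |b n * u n| + |x * u (n + 1)| :=
              (abs_sub _ _).trans (by gcongr; exact abs_add_le _ _)
          _ ≤ C * 1 + C * 1 + 2 * 1 := by
              simp only [abs_mul]
              gcongr <;> first | exact hb _ | exact hu1 _
          _ = _ := by ring
      have h3 : r (n + 1) ^ 2 ≤ (2 * C + 2) ^ 2 := by
        rw [← sq_abs]; gcongr
      have h4 : 0 ≤ (if n + 1 ∈ Finset.Ico N (N + K) then (2 * δ) ^ 2 else 0) := by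
        split_ifs <;> positivity
      linarith
    · rw [if_neg h1, add_zero]
      simp only [hF, Finset.mem_insert, Finset.mem_singleton, not_or] at h1
      by_cases h2 : n + 1 ∈ Finset.Ico N (N + K)
      · rw [if_pos h2]
        simp only [Finset.mem_Ico] at h2
        have h3 : r (n + 1) = (b (n + 1) - 1) * κ (n + 2) + (b n - 1) * κ n := by
          rw [hrn, hin (n + 2) (by simp; omega), hin n (by simp; omega),
            hin (n + 1) (by simp; omega), ← hrec n]
          ring
        have h4 : |r (n + 1)| ≤ 2 * δ := by
          rw [h3]
          calc _ ≤ |b (n + 1) - 1| * |κ (n + 2)| + |b n - 1| * |κ n| := by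
                rw [← abs_mul, ← abs_mul]; exact abs_add_le _ _
            _ ≤ δ * 1 + δ * 1 := by
                gcongr <;> first | exact hδ _ (by omega) | exact hκ _
            _ = _ := by ring
        rw [← sq_abs]; gcongr
      · rw [if_neg h2, hrn]
        simp only [Finset.mem_Ico] at h2
        rw [hz (n + 2) (by simp; omega), hz n (by simp; omega), hz (n + 1) (by simp; omega)]
        simp
  rw [SeqSpace.norm_sq_eq_sum hres hrz]
  refine (Finset.sum_le_sum fun n _ => hbound n).trans ?_
  rw [Finset.sum_add_distrib]
  refine add_le_add ?_ ?_
  · rw [← Finset.sum_filter, Finset.sum_const, nsmul_eq_mul]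
    gcongr
    calc _ ≤ (Finset.Ico N (N + K)).card := Finset.card_le_card fun n hn => by
            simpa using (Finset.mem_filter.1 hn).2
      _ = K := by simp
  · rw [← Finset.sum_filter, Finset.sum_const, nsmul_eq_mul]
    gcongr
    have h1 : (Finset.filter (fun n => n ∈ F) (Finset.range (N + K + 1))).card ≤ F.card :=
      Finset.card_le_card fun n hn => (Finset.mem_filter.1 hn).2
    have h2 : F.card ≤ 4 := Finset.card_le_four
    exact_mod_cast h1.trans h2

lemma norm_sq_window {κ u : ℕ → ℝ} {N K : ℕ}
    (hu : u = fun n => if n ∈ Finset.Ico N (N + K) then κ n else 0) :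
    ‖finVec u (N + K)‖ ^ 2 = ∑ n ∈ Finset.Ico N (N + K), κ n ^ 2 := by
  have hz : ∀ n, N + K ≤ n → u n = 0 := fun n hn => by
    rw [hu]; exact if_neg (by simp; omega)
  rw [SeqSpace.norm_sq_eq_sum (finVec_apply u hz) hz, hu]
  simp only [ite_pow, zero_pow two_ne_zero]
  rw [← Finset.sum_filter]
  refine Finset.sum_congr ?_ fun _ _ => rfl
  ext n; simp

/-- A Weyl sequence argument. With x = 2 cos θ, the waves cos nθ and sin nθ solve the free
recurrence, so on long distant windows they are approximate eigenvectors, against the lower bound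
that holds off the support. Taking both waves makes the squared norms add up to exactly `K`, for
every θ. -/
lemma Icc_subset_support (hpos : ∀ n, 0 < b n) (hlim : Tendsto b atTop (𝓝 1))
    (h : RepresentsSpectralMeasure (jacobiOp b C hb) (stdVec 0) μ) :
    Icc (-2) 2 ⊆ μ.support := by
  intro x hx
  by_contra hns
  obtain ⟨U, hU, hU0⟩ := Measure.notMem_support_iff_exists.1 hns
  obtain ⟨ε, hε, hball⟩ := Metric.mem_nhds_iff.1 hU
  have hb0 : μ (Metric.ball x ε) = 0 := measure_mono_null hball hU0
  set θ := Real.arccos (x / 2)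
  have hθ : 2 * Real.cos θ = x := by
    rw [Real.cos_arccos (by linarith [hx.1]) (by linarith [hx.2])]; ring
  obtain ⟨N₀, hN₀⟩ := (Metric.tendsto_atTop.1 hlim) (ε / 4) (by positivity)
  set N := max N₀ 2
  have hδ : ∀ n, N ≤ n → |b n - 1| ≤ ε / 4 := fun n hn => by
    rw [← Real.dist_eq]; exact (hN₀ n ((le_max_left _ _).trans hn)).le
  have hx2 : |x| ≤ 2 := abs_le.2 hx
  -- Adding the two estimates gives ε²K ≤ ε²K/2 + 8(2C + 2)², which fails for this `K`.
  obtain ⟨K, hK⟩ := exists_nat_gt (16 * (2 * C + 2) ^ 2 / ε ^ 2)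
  rw [div_lt_iff₀ (by positivity)] at hK
  have key : ∀ κ : ℕ → ℝ, (∀ n, |κ n| ≤ 1) → (∀ n, κ (n + 2) + κ n = x * κ (n + 1)) →
      ε ^ 2 * ∑ n ∈ Finset.Ico N (N + K), κ n ^ 2 ≤
        K * (2 * (ε / 4)) ^ 2 + 4 * (2 * C + 2) ^ 2 := by
    intro κ h1 h2
    rw [← norm_sq_window rfl]
    exact (h.norm_sub_smul_ge hε hb0 (isFunctionOf_finVec hpos _ _)).trans
      (norm_jacobiOp_window_le hx2 h1 h2 (le_max_right _ _) hδ rfl)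
  have hc := key (fun n => Real.cos (n * θ)) (fun n => Real.abs_cos_le_one _) fun n => by
    push_cast
    rw [← hθ, show ((n : ℝ) + 2) * θ = (n + 1) * θ + θ by ring,
      show (n : ℝ) * θ = (n + 1) * θ - θ by ring, Real.cos_add, Real.cos_sub]
    ring
  have hs := key (fun n => Real.sin (n * θ)) (fun n => Real.abs_sin_le_one _) fun n => by
    push_cast
    rw [← hθ, show ((n : ℝ) + 2) * θ = (n + 1) * θ + θ by ring,
      show (n : ℝ) * θ = (n + 1) * θ - θ by ring, Real.sin_add, Real.sin_sub]
    ring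
  have hsum : ∑ n ∈ Finset.Ico N (N + K), Real.cos (n * θ) ^ 2 +
      ∑ n ∈ Finset.Ico N (N + K), Real.sin (n * θ) ^ 2 = K := by
    rw [← Finset.sum_add_distrib]
    simp
  nlinarith

/-- On such vectors the weights `b n` with `n < N` only multiply zero coordinates, so they may be
replaced by 0 and the general norm bound applied. -/
lemma norm_jacobiOp_tail_le {δ : ℝ} {N : ℕ} (hδ : ∀ n, N ≤ n → |b n| ≤ 1 + δ) (h0 : 0 ≤ 1 + δ)
    {v : SeqSpace} (hv : ∀ n < N + 1, v n = 0) :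
    ‖jacobiOp b C hb v‖ ≤ 2 * (1 + δ) * ‖v‖ := by
  have hb' : ∀ n, |(if n < N then 0 else b n)| ≤ 1 + δ := fun n => by
    split_ifs with h
    · simpa using h0
    · exact hδ n (by omega)
  have e : jacobiOp b C hb v = jacobiOp (fun n => if n < N then 0 else b n) (1 + δ) hb' v := by
    ext n
    rcases n with _ | n
    · rw [jacobiOp_apply_zero, jacobiOp_apply_zero]
      split_ifs with h
      · rw [hv 1 (by omega)]; simp
      · rfl
    · rw [jacobiOp_apply_succ, jacobiOp_apply_succ]
      congr 1
      · split_ifs with h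
        · rw [hv (n + 2) (by omega)]; simp
        · rfl
      · split_ifs with h
        · rw [hv n (by omega)]; simp
        · rfl
  rw [e]
  exact norm_jacobiOp_apply_le v

open Polynomial in
/-- A nonzero multiple `χ p` of a cut-off function for which `(χ p)(L) v` is orthogonal to
finitely many given vectors. -/
lemma exists_polynomial_inner_eq_zero {H : Type*} [NormedAddCommGroup H] [InnerProductSpace ℂ H]
    [CompleteSpace H] (L : H →L[ℂ] H) (v : H) {χ : ℝ → ℝ} (hχ : Continuous χ) {N : ℕ}
    (e : Fin N → H) :
    ∃ p : ℝ[X], p ≠ 0 ∧ ∀ n, inner ℂ (e n) (cfc (fun y => χ y * p.eval y) L v) = 0 := by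
  have hc : ∀ p : ℝ[X], Continuous fun y => χ y * p.eval y := fun p => hχ.mul p.continuous
  let Φ : ℝ[X] →ₗ[ℝ] (Fin N → ℂ) :=
    { toFun := fun p n => inner ℂ (e n) (cfc (fun y => χ y * p.eval y) L v)
      map_add' := fun p q => by
        ext n
        simp only [eval_add, mul_add]
        rw [cfc_add (a := L) _ _ (hc p).continuousOn (hc q).continuousOn, add_apply,
          inner_add_right]
        rfl
      map_smul' := fun r p => by
        ext n
        simp only [eval_smul, smul_eq_mul, mul_left_comm]
        rw [cfc_const_mul r _ L (hc p).continuousOn, smul_apply, inner_smul_right_eq_smul]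
        rfl }
  -- The polynomials are infinite-dimensional over ℝ and the target is finite-dimensional.
  have hninj : ¬ Function.Injective Φ := fun hinj =>
    Polynomial.not_finite (R := ℝ) (Module.Finite.of_injective Φ hinj)
  rw [← LinearMap.ker_eq_bot, Submodule.eq_bot_iff] at hninj
  push Not at hninj
  obtain ⟨p, hp, hp0⟩ := hninj
  exact ⟨p, hp0, fun n => congrFun (LinearMap.mem_ker.1 hp) n⟩

/-- Let w = f(L) e₀ with f = χp vanishing on |y| ≤ 2 + δ and w orthogonal to e_0, …, e_N. Then ‖Lw‖
≤ (2 + δ)‖w‖, while (y² - (2 + δ)²) f² is nonnegative everywhere. Its integral is therefore 0, so p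
vanishes at every support point beyond 2 + δ; infinitely many such points would give p = 0. -/
lemma finite_support_outside (hlim : Tendsto b atTop (𝓝 1))
    (h : RepresentsSpectralMeasure (jacobiOp b C hb) (stdVec 0) μ) {δ : ℝ} (hδ : 0 < δ) :
    {x ∈ μ.support | 2 + δ < |x|}.Finite := by
  have := h.finite
  obtain ⟨R, hR⟩ := h.bounded
  obtain ⟨N, hN⟩ := (Metric.tendsto_atTop.1 hlim) (δ / 2) (by positivity)
  have hbN : ∀ n, N ≤ n → |b n| ≤ 1 + δ / 2 := fun n hn => by
    have h1 := (hN n hn).le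
    rw [Real.dist_eq] at h1
    calc |b n| = |1 + (b n - 1)| := by ring_nf
      _ ≤ |1| + |b n - 1| := abs_add_le _ _
      _ ≤ _ := by rw [abs_one]; linarith
  by_contra hinf
  set χ : ℝ → ℝ := fun y => max 0 (|y| - (2 + δ)) with hχdef
  have hχ : Continuous χ := by fun_prop
  obtain ⟨p, hp0, hp⟩ := exists_polynomial_inner_eq_zero (jacobiOp b C hb) (stdVec 0) hχ
    fun n : Fin (N + 1) => stdVec n
  set f : ℝ → ℝ := fun y => χ y * p.eval y with hfdef
  have hf : Continuous f := hχ.mul p.continuous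
  have hle := norm_jacobiOp_tail_le (hb := hb) hbN (by positivity)
    fun n hn => (inner_stdVec_left n _).symm.trans (hp ⟨n, hn⟩)
  have h1 := h.integral_sq hf
  have h2 := h.integral_sq (f := fun y => y * f y) (continuous_id.mul hf)
  rw [cfc_id_mul h.selfAdjoint hf, mul_apply_eq_comp] at h2
  set g : ℝ → ℝ := fun y => (y * f y) ^ 2 - (2 + δ) ^ 2 * f y ^ 2 with hgdef
  have hg : Continuous g := by fun_prop
  have hg0 : ∀ y, 0 ≤ g y := by
    intro y
    by_cases hy : |y| ≤ 2 + δ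
    · have : f y = 0 := by simp [hfdef, hχdef, hy]
      simp [hgdef, this]
    · have : (2 + δ) ^ 2 ≤ y ^ 2 := by
        rw [← sq_abs y]; push Not at hy; gcongr
      simp only [hgdef, mul_pow]
      nlinarith [sq_nonneg (f y)]
  have hgi : ∫ y, g y ∂μ ≤ 0 := by
    rw [integral_sub (integrable_of_continuous_of_compl_Icc hR (by fun_prop))
      (integrable_of_continuous_of_compl_Icc hR (by fun_prop)), integral_const_mul, h1, h2]
    have := pow_le_pow_left₀ (norm_nonneg _) hle 2
    rw [mul_pow] at this
    have e : (2 * (1 + δ / 2)) ^ 2 = (2 + δ) ^ 2 := by ring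
    rw [e] at this
    linarith
  apply hp0
  refine Polynomial.eq_zero_of_infinite_isRoot p (Set.Infinite.mono (fun y hy => ?_) hinf)
  have h3 := eq_zero_of_mem_support_of_integral_nonpos hg hg0
    (integrable_of_continuous_of_compl_Icc hR hg) hgi hy.1
  have h4 : (2 + δ) ^ 2 < y ^ 2 := by
    rw [← sq_abs y]; have := hy.2; gcongr
  have h5 : (y ^ 2 - (2 + δ) ^ 2) * f y ^ 2 = 0 := by rw [← h3, hgdef]; ring
  have h6 : f y = 0 := by
    rcases mul_eq_zero.1 h5 with h6 | h6
    · linarith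
    · exact pow_eq_zero_iff two_ne_zero |>.1 h6
  rcases mul_eq_zero.1 h6 with h7 | h7
  · have h8 := le_max_right 0 (|y| - (2 + δ))
    have h9 : |y| - (2 + δ) ≤ 0 := h8.trans h7.le
    linarith [hy.2]
  · exact h7

/-! ### Measures with essentially bounded support -/

lemma not_accPt_support (hfin : ∀ δ > 0, {x ∈ μ.support | 2 + δ < |x|}.Finite) {x : ℝ}
    (hx : 2 < |x|) : ¬ AccPt x (𝓟 μ.support) := by
  intro hacc
  have hO : {y : ℝ | 2 + (|x| - 2) / 2 < |y|} ∈ 𝓝 x :=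
    (isOpen_lt continuous_const continuous_abs).mem_nhds (by
      change 2 + (|x| - 2) / 2 < |x|; linarith)
  have h : AccPt x (𝓟 {y ∈ μ.support | 2 + (|x| - 2) / 2 < |y|}) := by
    rw [accPt_iff_frequently] at hacc ⊢
    exact (hacc.and_eventually hO).mono fun y hy => ⟨hy.1.1, hy.1.2, hy.2⟩
  exact Set.Infinite.of_accPt h (hfin _ (by linarith))

lemma essentialSupport_eq_Icc (hsub : Icc (-2) 2 ⊆ μ.support)
    (hfin : ∀ δ > 0, {x ∈ μ.support | 2 + δ < |x|}.Finite) :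
    essentialSupport μ = Icc (-2) 2 := by
  refine subset_antisymm (fun x hx => ?_) fun x hx => ⟨hsub hx, ?_⟩
  · by_contra h
    refine not_accPt_support hfin ?_ hx.2
    by_contra h'
    exact h (abs_le.1 (not_lt.1 h'))
  · have h1 : AccPt x (𝓟 (Icc (-2 : ℝ) 2)) := by
      have := (isPreconnected_Icc (a := (-2 : ℝ)) (b := 2)).preperfect_of_nontrivial
        ⟨-2, by norm_num, 2, by norm_num, by norm_num⟩
      exact this x hx
    exact h1.mono (principal_mono.2 hsub)

lemma outerMassPoints_subset : outerMassPoints μ ⊆ {x ∈ μ.support | 2 < |x|} := by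
  rintro x ⟨hx, hm⟩
  refine ⟨(Measure.mem_support_iff_forall x).2 fun U hU => ?_, ?_⟩
  · exact (pos_iff_ne_zero.2 hm).trans_le (measure_mono (singleton_subset_iff.2 (mem_of_mem_nhds hU)))
  · by_contra h'
    exact hx (abs_le.1 (not_lt.1 h'))

lemma countable_outerMassPoints (hfin : ∀ δ > 0, {x ∈ μ.support | 2 + δ < |x|}.Finite) :
    (outerMassPoints μ).Countable := by
  have h : outerMassPoints μ ⊆ ⋃ k : ℕ, {x ∈ μ.support | 2 + 1 / ((k : ℝ) + 1) < |x|} := by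
    intro x hx
    obtain ⟨h1, h2⟩ := outerMassPoints_subset hx
    obtain ⟨k, hk⟩ := exists_nat_one_div_lt (sub_pos.2 h2)
    exact mem_iUnion.2 ⟨k, h1, by linarith⟩
  exact (countable_iUnion fun k => (hfin _ (by positivity)).countable).mono h

lemma derivedSet_outerMassPoints (hfin : ∀ δ > 0, {x ∈ μ.support | 2 + δ < |x|}.Finite) :
    derivedSet (outerMassPoints μ) ⊆ {-2, 2} := by
  intro x hx
  rcases lt_trichotomy |x| 2 with h | h | h
  · exfalso
    have hO : {y : ℝ | |y| < 2} ∈ 𝓝 x := (isOpen_lt continuous_abs continuous_const).mem_nhds h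
    rw [mem_derivedSet, accPt_iff_frequently] at hx
    obtain ⟨y, hy, hy'⟩ := (hx.and_eventually hO).exists
    exact lt_asymm (outerMassPoints_subset hy.2).2 hy'
  · rcases (abs_eq (by norm_num)).1 h with h | h <;> simp [h]
  · exact absurd (AccPt.mono hx (principal_mono.2 fun y hy => (outerMassPoints_subset hy).1))
      (not_accPt_support hfin h)

end

noncomputable section

/-! ### Compactly supported measures and their moments -/

/-- Moments of at most geometric growth force compact support. -/
lemma measure_compl_Icc_eq_zero_of_moments {μ : Measure ℝ} [IsFiniteMeasure μ] {C R : ℝ}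
    (hR : 0 ≤ R) (hint : ∀ k : ℕ, Integrable (fun x : ℝ => x ^ k) μ)
    (hle : ∀ k, momentOf μ (2 * k) ≤ C * R ^ (2 * k)) : μ (Icc (-(R + 1)) (R + 1))ᶜ = 0 := by
  set S := (Icc (-(R + 1)) (R + 1))ᶜ with hS
  have hsub : ∀ k : ℕ, S ⊆ {x : ℝ | (R + 1) ^ (2 * k) ≤ x ^ (2 * k)} := by
    intro k x hx
    have h1 : R + 1 ≤ |x| := by
      by_contra h
      exact hx (abs_le.1 (not_le.1 h).le)
    calc (R + 1) ^ (2 * k) ≤ |x| ^ (2 * k) := by gcongr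
      _ = x ^ (2 * k) := by rw [pow_mul, pow_mul, sq_abs]
  have hbound : ∀ k : ℕ, μ.real S ≤ C * ((R / (R + 1)) ^ 2) ^ k := by
    intro k
    have h1 := mul_meas_ge_le_integral_of_nonneg (μ := μ) (f := fun x : ℝ => x ^ (2 * k))
      (Eventually.of_forall fun x => by simp only [pow_mul]; positivity) (hint _)
      ((R + 1) ^ (2 * k))
    have h2 : (R + 1) ^ (2 * k) * μ.real S ≤ C * R ^ (2 * k) := by
      refine le_trans ?_ (h1.trans (hle k))
      gcongr
      · exact measure_ne_top _ _
      · exact hsub k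
    rw [← pow_mul, div_pow, ← mul_div_assoc, le_div_iff₀ (by positivity)]
    linarith
  have hlim : Tendsto (fun k : ℕ => C * ((R / (R + 1)) ^ 2) ^ k) atTop (𝓝 (C * 0)) := by
    refine (tendsto_pow_atTop_nhds_zero_of_lt_one (by positivity) ?_).const_mul C
    have : R / (R + 1) < 1 := by rw [div_lt_one (by positivity)]; linarith
    have h0 : 0 ≤ R / (R + 1) := by positivity
    nlinarith
  rw [mul_zero] at hlim
  have h0 : μ.real S ≤ 0 := ge_of_tendsto' hlim hbound
  exact (measureReal_eq_zero_iff).1 (le_antisymm h0 measureReal_nonneg)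

lemma measure_compl_Icc_mono {μ : Measure ℝ} {R R' : ℝ} (hR : μ (Icc (-R) R)ᶜ = 0)
    (h : R ≤ R') : μ (Icc (-R') R')ᶜ = 0 :=
  measure_mono_null (compl_subset_compl.2 (Icc_subset_Icc (by linarith) h)) hR

lemma ae_abs_le {μ : Measure ℝ} {R : ℝ} (hR : μ (Icc (-R) R)ᶜ = 0) : ∀ᵐ x ∂μ, |x| ≤ R := by
  filter_upwards [measure_eq_zero_iff_ae_notMem.1 hR] with x hx
  exact abs_le.2 (not_not.1 hx)

lemma integral_polynomial_eq_of_moments {μ ν : Measure ℝ}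
    (hμi : ∀ k : ℕ, Integrable (fun x : ℝ => x ^ k) μ)
    (hνi : ∀ k : ℕ, Integrable (fun x : ℝ => x ^ k) ν)
    (h : ∀ k, momentOf μ k = momentOf ν k) (p : Polynomial ℝ) :
    ∫ x, p.eval x ∂μ = ∫ x, p.eval x ∂ν := by
  simp only [Polynomial.eval_eq_sum_range]
  rw [integral_finsetSum _ fun i _ => (hμi i).const_mul _,
    integral_finsetSum _ fun i _ => (hνi i).const_mul _]
  refine Finset.sum_congr rfl fun i _ => ?_
  rw [integral_const_mul, integral_const_mul]
  exact congrArg _ (h i)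

/-- Compactly supported finite measures with the same moments are equal. -/
lemma measure_ext_of_moments_of_compl_Icc {μ ν : Measure ℝ} [IsFiniteMeasure μ]
    [IsFiniteMeasure ν] {R : ℝ} (hμ : μ (Icc (-R) R)ᶜ = 0) (hν : ν (Icc (-R) R)ᶜ = 0)
    (h : ∀ k, momentOf μ k = momentOf ν k) : μ = ν := by
  refine ext_of_forall_integral_eq_of_IsFiniteMeasure fun f => ?_
  have hi : ∀ (m : Measure ℝ) [IsFiniteMeasure m], m (Icc (-R) R)ᶜ = 0 → ∀ p : Polynomial ℝ,
      Integrable (fun x => p.eval x) m := fun _ _ hm p =>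
    integrable_of_continuous_of_compl_Icc hm p.continuous
  have hpow : ∀ (m : Measure ℝ) [IsFiniteMeasure m], m (Icc (-R) R)ᶜ = 0 → ∀ k : ℕ,
      Integrable (fun x : ℝ => x ^ k) m := fun _ _ hm k =>
    integrable_of_continuous_of_compl_Icc hm (continuous_pow k)
  have close : ∀ (m : Measure ℝ) [IsFiniteMeasure m], m (Icc (-R) R)ᶜ = 0 → ∀ (p : Polynomial ℝ)
      (ε : ℝ), (∀ x ∈ Icc (-R) R, |p.eval x - f x| < ε) →
      |∫ x, p.eval x ∂m - ∫ x, f x ∂m| ≤ ε * m.real univ := by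
    intro m _ hm p ε hp
    rw [← integral_sub (hi m hm p) (f.integrable m)]
    rw [← Real.norm_eq_abs]
    refine norm_integral_le_of_norm_le_const (μ := m) ?_
    filter_upwards [ae_abs_le hm] with x hx
    exact (hp x (abs_le.1 hx)).le
  have hpq := integral_polynomial_eq_of_moments (hpow μ hμ) (hpow ν hν) h
  refine eq_of_forall_dist_le fun ε hε => ?_
  set D := μ.real univ + ν.real univ + 1 with hD
  have hD0 : 0 < D := by positivity
  obtain ⟨p, hp⟩ := exists_polynomial_near_of_continuousOn (-R) R f f.continuous.continuousOn
    (ε / D) (by positivity)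
  have h1 := close μ hμ p _ hp
  have h2 := close ν hν p _ hp
  rw [hpq p] at h1
  rw [Real.dist_eq]
  have h3 : ε / D * (μ.real univ + ν.real univ) ≤ ε := by
    rw [div_mul_eq_mul_div, div_le_iff₀ hD0]
    nlinarith
  rw [abs_le] at *
  constructor <;> nlinarith [h1.1, h1.2, h2.1, h2.2]

/-- A compactly supported finite measure is determined by its moments among all finite measures
with finite moments. -/
lemma measure_ext_of_moments {μ ν : Measure ℝ} [IsFiniteMeasure μ] [IsFiniteMeasure ν] {R : ℝ}
    (hμ : μ (Icc (-R) R)ᶜ = 0) (hνi : ∀ k : ℕ, Integrable (fun x : ℝ => x ^ k) ν)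
    (h : ∀ k, momentOf μ k = momentOf ν k) : μ = ν := by
  have hμ' := measure_compl_Icc_mono hμ (le_abs_self R)
  -- Compact support of `ν` is not assumed: it follows from the geometric growth of the moments
  -- shared with `μ`.
  have hν : ν (Icc (-(|R| + 1)) (|R| + 1))ᶜ = 0 := by
    refine measure_compl_Icc_eq_zero_of_moments (C := μ.real univ) (abs_nonneg R) hνi fun k => ?_
    rw [← h, mul_comm (μ.real univ)]
    refine (Real.le_norm_self _).trans (norm_integral_le_of_norm_le_const ?_)
    filter_upwards [ae_abs_le hμ'] with x hx
    rw [norm_pow, Real.norm_eq_abs]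
    gcongr
  exact measure_ext_of_moments_of_compl_Icc (measure_compl_Icc_mono hμ' (by linarith)) hν h

lemma momentOf_map_neg (μ : Measure ℝ) (k : ℕ) :
    momentOf (μ.map fun x => -x) k = (-1) ^ k * momentOf μ k := by
  rw [momentOf, integral_map (by fun_prop) (by fun_prop), momentOf, ← integral_const_mul]
  exact integral_congr_ae (Eventually.of_forall fun x => neg_pow x k)

lemma momentOf_eq_zero_of_even {μ : Measure ℝ} (hμ : μ.map (fun x => -x) = μ) {k : ℕ}
    (hk : Odd k) : momentOf μ k = 0 := by
  have h := momentOf_map_neg μ k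
  rw [hμ, hk.neg_one_pow] at h
  linarith

lemma map_neg_eq_self_of_moments {μ : Measure ℝ} [IsFiniteMeasure μ] {R : ℝ}
    (hμ : μ (Icc (-R) R)ᶜ = 0) (h : ∀ k, Odd k → momentOf μ k = 0) :
    μ.map (fun x => -x) = μ := by
  refine measure_ext_of_moments_of_compl_Icc (R := R) ?_ hμ fun k => ?_
  · rw [Measure.map_apply (by fun_prop) measurableSet_Icc.compl, preimage_compl]
    simpa using hμ
  · rw [momentOf_map_neg]
    rcases Nat.even_or_odd k with hk | hk
    · rw [hk.neg_one_pow, one_mul]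
    · rw [h k hk, mul_zero]

/-! ### Positivity of the Hankel determinants -/

/-- The Hankel quadratic form at `c` is ∫ p² dμ for the polynomial p with coefficients `c`, and a
nonzero polynomial cannot vanish on an infinite support. -/
lemma seqHankelDet_momentOf_pos {μ : Measure ℝ}
    (hint : ∀ k : ℕ, Integrable (fun x : ℝ => x ^ k) μ) (hinf : μ.support.Infinite) (n : ℕ) :
    0 < seqHankelDet (momentOf μ) n := by
  refine Matrix.PosDef.det_pos (Matrix.PosDef.of_dotProduct_mulVec_pos ?_ fun c hc => ?_)
  · ext i j
    simp [add_comm]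
  set p : Polynomial ℝ := ∑ i : Fin n, Polynomial.monomial (i : ℕ) (c i) with hp
  have hpe : ∀ x, p.eval x = ∑ i : Fin n, c i * x ^ (i : ℕ) := fun x => by
    simp [hp, Polynomial.eval_finsetSum]
  have hsq : ∀ x, p.eval x ^ 2 = ∑ i : Fin n, ∑ j : Fin n,
      c i * c j * x ^ ((i : ℕ) + (j : ℕ)) := fun x => by
    rw [hpe, sq, Finset.sum_mul_sum]
    refine Finset.sum_congr rfl fun i _ => Finset.sum_congr rfl fun j _ => by ring
  have hi2 : ∀ i j : Fin n, Integrable (fun x => c i * c j * x ^ ((i : ℕ) + (j : ℕ))) μ :=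
    fun i j => (hint _).const_mul _
  have hq : star c ⬝ᵥ (Matrix.of fun i j : Fin n => momentOf μ ((i : ℕ) + (j : ℕ))).mulVec c =
      ∫ x, p.eval x ^ 2 ∂μ := by
    simp only [hsq]
    rw [integral_finsetSum _ fun i _ => integrable_finsetSum _ fun j _ => hi2 i j]
    simp only [dotProduct, Matrix.mulVec, Matrix.of_apply, Finset.mul_sum]
    refine Finset.sum_congr rfl fun i _ => ?_
    rw [integral_finsetSum _ fun j _ => hi2 i j]
    refine Finset.sum_congr rfl fun j _ => ?_
    rw [integral_const_mul]
    simp only [Pi.star_apply, star_trivial, momentOf]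
    ring
  rw [hq]
  by_contra hle
  have hint2 : Integrable (fun x => p.eval x ^ 2) μ := by
    simp only [hsq]
    exact integrable_finsetSum _ fun i _ => integrable_finsetSum _ fun j _ => hi2 i j
  have hp0 : p = 0 := by
    refine Polynomial.eq_zero_of_infinite_isRoot p (hinf.mono fun x hx => ?_)
    have h := eq_zero_of_mem_support_of_integral_nonpos (by fun_prop) (fun x => sq_nonneg _) hint2
      (not_lt.1 hle) hx
    exact pow_eq_zero_iff two_ne_zero |>.1 h
  apply hc
  ext i
  have h : p.coeff i = c i := by
    rw [hp, Polynomial.finsetSum_coeff, Finset.sum_eq_single i]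
    · simp
    · intro j _ hj
      rw [Polynomial.coeff_monomial, if_neg (by simpa [Fin.ext_iff] using hj)]
    · simp
  rw [← h, hp0]; simp

/-! ### Exponential moments -/

/-- `∫ x^k e^{x² t} dμ`. -/
def expMoment (μ : Measure ℝ) (k : ℕ) (t : ℝ) : ℝ := ∫ x, x ^ k * Real.exp (x ^ 2 * t) ∂μ

lemma expMoment_zero_right (μ : Measure ℝ) (k : ℕ) : expMoment μ k 0 = momentOf μ k := by
  simp [expMoment, momentOf]

lemma expMoment_zero_left (μ : Measure ℝ) (t : ℝ) :
    expMoment μ 0 t = ∫ x, Real.exp (x ^ 2 * t) ∂μ := by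
  simp [expMoment]

lemma expMoment_even_nonneg (μ : Measure ℝ) (k : ℕ) (t : ℝ) : 0 ≤ expMoment μ (2 * k) t :=
  integral_nonneg fun x => by
    simp only [pow_mul]; positivity

lemma hasDerivAt_expMoment {μ : Measure ℝ} [IsFiniteMeasure μ] {R : ℝ}
    (hR : μ (Icc (-R) R)ᶜ = 0) (k : ℕ) (t : ℝ) :
    HasDerivAt (expMoment μ k) (expMoment μ (k + 2) t) t := by
  have hc : ∀ (k : ℕ) (t : ℝ), Continuous fun x : ℝ => x ^ k * Real.exp (x ^ 2 * t) :=
    fun k t => by fun_prop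
  refine (hasDerivAt_integral_of_dominated_loc_of_deriv_le (μ := μ)
    (F := fun t x => x ^ k * Real.exp (x ^ 2 * t))
    (F' := fun t x => x ^ (k + 2) * Real.exp (x ^ 2 * t))
    (bound := fun x => |x| ^ (k + 2) * Real.exp (x ^ 2 * (t + 1)))
    (Metric.ball_mem_nhds t one_pos)
    (Eventually.of_forall fun s => (hc k s).aestronglyMeasurable)
    (integrable_of_continuous_of_compl_Icc hR (hc k t)) (hc _ t).aestronglyMeasurable
    (Eventually.of_forall fun x s hs => ?_)
    (integrable_of_continuous_of_compl_Icc hR (by fun_prop))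
    (Eventually.of_forall fun x s _ => ?_)).2
  · rw [norm_mul, norm_pow, Real.norm_eq_abs, Real.norm_eq_abs, Real.abs_exp]
    rw [Metric.mem_ball, Real.dist_eq, abs_lt] at hs
    gcongr
    linarith
  · have h1 : HasDerivAt (fun s : ℝ => x ^ 2 * s) (x ^ 2) s := by
      simpa using (hasDerivAt_id s).const_mul (x ^ 2)
    refine ((h1.exp).const_mul (x ^ k)).congr_deriv ?_
    ring

lemma expMoment_zero_pos {μ : Measure ℝ} [IsProbabilityMeasure μ] {R : ℝ}
    (hR : μ (Icc (-R) R)ᶜ = 0) (t : ℝ) : 0 < expMoment μ 0 t := by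
  rw [expMoment_zero_left]
  exact integral_exp_pos (integrable_of_continuous_of_compl_Icc hR (by fun_prop))

/-- The normalized measure `e^{x² t} dμ / ∫ e^{x² t} dμ`. -/
def expTilt (μ : Measure ℝ) (t : ℝ) : Measure ℝ :=
  μ.withDensity fun x => ENNReal.ofReal (Real.exp (x ^ 2 * t) / ∫ y, Real.exp (y ^ 2 * t) ∂μ)

lemma momentOf_expTilt (μ : Measure ℝ) (t : ℝ) (k : ℕ) :
    momentOf (expTilt μ t) k = expMoment μ k t / expMoment μ 0 t := by
  rw [momentOf, expTilt, integral_withDensity_eq_integral_toReal_smul (by fun_prop)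
    (Eventually.of_forall fun x => ENNReal.ofReal_lt_top), expMoment_zero_left, expMoment,
    ← integral_div]
  refine integral_congr_ae (Eventually.of_forall fun x => ?_)
  have h : 0 ≤ ∫ y, Real.exp (y ^ 2 * t) ∂μ := integral_nonneg fun y => (Real.exp_pos _).le
  simp only [smul_eq_mul]
  rw [ENNReal.toReal_ofReal (div_nonneg (Real.exp_pos _).le h)]
  ring

lemma expTilt_compl_Icc {μ : Measure ℝ} {R : ℝ} (hR : μ (Icc (-R) R)ᶜ = 0) (t : ℝ) :
    expTilt μ t (Icc (-R) R)ᶜ = 0 :=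
  withDensity_absolutelyContinuous μ _ hR

lemma isFiniteMeasure_expTilt {μ : Measure ℝ} [IsFiniteMeasure μ] {R : ℝ}
    (hR : μ (Icc (-R) R)ᶜ = 0) (t : ℝ) : IsFiniteMeasure (expTilt μ t) :=
  isFiniteMeasure_withDensity_ofReal
    (integrable_of_continuous_of_compl_Icc hR (by fun_prop)).hasFiniteIntegral

lemma expMoment_eq_zero_of_even {μ : Measure ℝ} (hμ : μ.map (fun x => -x) = μ) {k : ℕ}
    (hk : Odd k) (t : ℝ) : expMoment μ k t = 0 := by
  have h : expMoment μ k t = -expMoment μ k t := by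
    conv_lhs => rw [← hμ]
    rw [expMoment, integral_map (by fun_prop) (by fun_prop), expMoment, ← integral_neg]
    refine integral_congr_ae (Eventually.of_forall fun x => ?_)
    simp only [hk.neg_pow, neg_sq]
    ring
  linarith

/-! ### Absolutely monotone families -/

/-- The Taylor remainder at `0` of order `n` of `f_k`, where `f_k' = f_{k+1}`. -/
def taylorRemainder (f : ℕ → ℝ → ℝ) (n k : ℕ) (x : ℝ) : ℝ :=
  f k x - ∑ j ∈ Finset.range n, f (k + j) 0 * (x ^ j / j.factorial)

lemma taylorRemainder_zero (f : ℕ → ℝ → ℝ) (k : ℕ) (x : ℝ) :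
    taylorRemainder f 0 k x = f k x := by simp [taylorRemainder]

lemma taylorRemainder_succ_apply_zero (f : ℕ → ℝ → ℝ) (n k : ℕ) :
    taylorRemainder f (n + 1) k 0 = 0 := by
  simp [taylorRemainder, Finset.sum_range_succ']

lemma hasDerivWithinAt_taylorRemainder {f : ℕ → ℝ → ℝ} {b : ℝ}
    (hf : ∀ k, ∀ x ∈ Icc 0 b, HasDerivWithinAt (f k) (f (k + 1) x) (Icc 0 b) x) (n k : ℕ) {x : ℝ}
    (hx : x ∈ Icc 0 b) : HasDerivWithinAt (taylorRemainder f (n + 1) k)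
      (taylorRemainder f n (k + 1) x) (Icc 0 b) x := by
  have h : ∀ j : ℕ, HasDerivAt (fun x : ℝ => f (k + (j + 1)) 0 * (x ^ (j + 1) / (j + 1).factorial))
      (f (k + 1 + j) 0 * (x ^ j / j.factorial)) x := fun j => by
    refine (((hasDerivAt_pow (j + 1) x).div_const _).const_mul _).congr_deriv ?_
    have h1 : (j.factorial : ℝ) ≠ 0 := by positivity
    rw [show k + 1 + j = k + (j + 1) by ring, Nat.factorial_succ]
    push_cast
    field_simp
  have hs := HasDerivAt.fun_sum (u := Finset.range n) fun j _ => h j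
  have e : taylorRemainder f (n + 1) k = fun x => f k x - (∑ j ∈ Finset.range n,
      f (k + (j + 1)) 0 * (x ^ (j + 1) / (j + 1).factorial) + f k 0) := by
    ext y
    simp [taylorRemainder, Finset.sum_range_succ']
  rw [e]
  exact (hf k x hx).sub ((hs.add_const _).hasDerivWithinAt)

lemma monotoneOn_Icc_of_hasDerivWithinAt {φ φ' : ℝ → ℝ} {b : ℝ}
    (hφ : ∀ x ∈ Icc 0 b, HasDerivWithinAt φ (φ' x) (Icc 0 b) x)
    (h' : ∀ x ∈ Icc 0 b, 0 ≤ φ' x) : MonotoneOn φ (Icc 0 b) :=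
  monotoneOn_of_hasDerivWithinAt_nonneg (convex_Icc 0 b) (fun x hx => (hφ x hx).continuousWithinAt)
    (fun x hx => (hφ x (interior_subset hx)).mono interior_subset)
    (fun x hx => h' x (interior_subset hx))

/-- By induction on the order: the remainder vanishes at 0 and its derivative is the remainder of
order one less of the next function. -/
lemma taylorRemainder_nonneg {f : ℕ → ℝ → ℝ} {b : ℝ}
    (hf : ∀ k, ∀ x ∈ Icc 0 b, HasDerivWithinAt (f k) (f (k + 1) x) (Icc 0 b) x)
    (hpos : ∀ k, ∀ x ∈ Icc 0 b, 0 ≤ f k x) (n : ℕ) :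
    ∀ k, ∀ x ∈ Icc 0 b, 0 ≤ taylorRemainder f n k x := by
  induction n with
  | zero => intro k x hx; rw [taylorRemainder_zero]; exact hpos k x hx
  | succ n ih =>
    intro k x hx
    have hm := monotoneOn_Icc_of_hasDerivWithinAt
      (fun y hy => hasDerivWithinAt_taylorRemainder hf n k hy) (ih (k + 1))
    have := hm ⟨le_rfl, hx.1.trans hx.2⟩ hx hx.1
    rwa [taylorRemainder_succ_apply_zero] at this

/-- The factor θ^n is the source of convergence: for x = b and θ = t/b < 1 the remainder at t decays
geometrically. -/
lemma taylorRemainder_mul_le {f : ℕ → ℝ → ℝ} {b θ : ℝ} (hθ : θ ∈ Icc (0 : ℝ) 1)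
    (hf : ∀ k, ∀ x ∈ Icc 0 b, HasDerivWithinAt (f k) (f (k + 1) x) (Icc 0 b) x)
    (hpos : ∀ k, ∀ x ∈ Icc 0 b, 0 ≤ f k x) (n : ℕ) :
    ∀ k, ∀ x ∈ Icc 0 b, taylorRemainder f n k (θ * x) ≤ θ ^ n * taylorRemainder f n k x := by
  have hmaps : MapsTo (fun x => θ * x) (Icc 0 b) (Icc 0 b) := fun x hx =>
    ⟨mul_nonneg hθ.1 hx.1, (mul_le_of_le_one_left hx.1 hθ.2).trans hx.2⟩
  induction n with
  | zero =>
    intro k x hx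
    rw [taylorRemainder_zero, taylorRemainder_zero, pow_zero, one_mul]
    exact monotoneOn_Icc_of_hasDerivWithinAt (hf k) (hpos (k + 1)) (hmaps hx) hx
      (mul_le_of_le_one_left hx.1 hθ.2)
  | succ n ih =>
    intro k x hx
    have hd : ∀ y ∈ Icc 0 b, HasDerivWithinAt
        (fun y => θ ^ (n + 1) * taylorRemainder f (n + 1) k y - taylorRemainder f (n + 1) k (θ * y))
        (θ * (θ ^ n * taylorRemainder f n (k + 1) y - taylorRemainder f n (k + 1) (θ * y)))
        (Icc 0 b) y := by
      intro y hy
      have h1 := hasDerivWithinAt_taylorRemainder hf n k hy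
      have h2 := hasDerivWithinAt_taylorRemainder hf n k (hmaps hy)
      have h3 : HasDerivWithinAt (fun y => θ * y) θ (Icc 0 b) y := by
        simpa using (hasDerivWithinAt_id y (Icc 0 b)).const_mul θ
      refine ((h1.const_mul (θ ^ (n + 1))).sub (h2.comp y h3 hmaps)).congr_deriv ?_
      ring
    have hm := monotoneOn_Icc_of_hasDerivWithinAt hd fun y hy =>
      mul_nonneg hθ.1 (sub_nonneg.2 (ih (k + 1) y hy))
    have := hm ⟨le_rfl, hx.1.trans hx.2⟩ hx hx.1
    simp only [mul_zero, taylorRemainder_succ_apply_zero, sub_self] at this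
    linarith

/-- Bernstein's theorem: an absolutely monotone function on `[0, b]` is the sum of its Taylor
series at `0` on `[0, b)`. -/
lemma tendsto_taylorRemainder {f : ℕ → ℝ → ℝ} {b t : ℝ}
    (hf : ∀ k, ∀ x ∈ Icc 0 b, HasDerivWithinAt (f k) (f (k + 1) x) (Icc 0 b) x)
    (hpos : ∀ k, ∀ x ∈ Icc 0 b, 0 ≤ f k x) (ht : 0 ≤ t) (htb : t < b) (k : ℕ) :
    Tendsto (fun n => taylorRemainder f n k t) atTop (𝓝 0) := by
  have hb : 0 < b := ht.trans_lt htb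
  have hbm : b ∈ Icc 0 b := ⟨hb.le, le_rfl⟩
  have hlim : Tendsto (fun n : ℕ => (t / b) ^ n * f k b) atTop (𝓝 (0 * f k b)) :=
    (tendsto_pow_atTop_nhds_zero_of_lt_one (by positivity) ((div_lt_one hb).2 htb)).mul_const _
  rw [zero_mul] at hlim
  refine squeeze_zero (fun n => taylorRemainder_nonneg hf hpos n k t ⟨ht, htb.le⟩) (fun n => ?_) hlim
  have h1 := taylorRemainder_mul_le (θ := t / b) ⟨by positivity, ((div_lt_one hb).2 htb).le⟩ hf hpos
    n k b hbm
  rw [div_mul_cancel₀ _ hb.ne'] at h1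
  refine h1.trans ?_
  gcongr
  refine sub_le_self _ (Finset.sum_nonneg fun j _ => mul_nonneg (hpos _ _ ⟨le_rfl, hb.le⟩) ?_)
  positivity

/-- The infinite system f_k' = f_{k+1} alone is not uniquely solvable (flat functions).
Nonnegativity makes each solution equal to its Taylor series, which is fixed by the values at 0. -/
lemma eq_of_absolutelyMonotone {f g : ℕ → ℝ → ℝ} {b t : ℝ}
    (hf : ∀ k, ∀ x ∈ Icc 0 b, HasDerivWithinAt (f k) (f (k + 1) x) (Icc 0 b) x)
    (hfpos : ∀ k, ∀ x ∈ Icc 0 b, 0 ≤ f k x)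
    (hg : ∀ k, ∀ x ∈ Icc 0 b, HasDerivWithinAt (g k) (g (k + 1) x) (Icc 0 b) x)
    (hgpos : ∀ k, ∀ x ∈ Icc 0 b, 0 ≤ g k x) (h0 : ∀ k, f k 0 = g k 0)
    (ht : 0 ≤ t) (htb : t < b) (k : ℕ) : f k t = g k t := by
  have h := (tendsto_taylorRemainder hf hfpos ht htb k).sub
    (tendsto_taylorRemainder hg hgpos ht htb k)
  have e : (fun n => taylorRemainder f n k t - taylorRemainder g n k t) =
      fun _ => f k t - g k t := by
    ext n
    simp only [taylorRemainder, h0]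
    ring
  rw [e, sub_zero] at h
  exact sub_eq_zero.1 (tendsto_nhds_unique tendsto_const_nhds h)

end

noncomputable section

/-! ### Lattices with finite logarithmic Hamiltonian at a fixed time -/

variable {a : ℕ → ℝ}

lemma log_normSqProd (ha : ∀ n, 0 < a n) (N : ℕ) :
    Real.log (normSqProd a N) = ∑ n ∈ Finset.range N, Real.log (a n) :=
  Real.log_prod fun n _ => (ha n).ne'

/-- The partial product is the exponential of twice the partial Hamiltonian. The shift by one makes
it Δ_{n+1}/Δ_n in the indexing of `IsAdmissible`. -/
lemma hasFiniteLogHamiltonian_iff (ha : ∀ n, 0 < a n) :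
    HasFiniteLogHamiltonian a ↔ ∃ l : ℝ, 0 < l ∧
      Tendsto (fun n => normSqProd a (n + 1)) atTop (𝓝 l) := by
  constructor
  · rintro ⟨H, hH⟩
    refine ⟨Real.exp (2 * H), Real.exp_pos _, ?_⟩
    have h1 := ((Real.continuous_exp.tendsto _).comp (hH.const_mul 2))
    refine (h1.comp (tendsto_add_atTop_nat 1)).congr fun n => ?_
    simp only [Function.comp]
    rw [← log_normSqProd ha, ← mul_assoc, show (2 : ℝ) * (1 / 2) = 1 by norm_num, one_mul,
      Real.exp_log (normSqProd_pos ha _)]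
  · rintro ⟨l, hl, h⟩
    refine ⟨1 / 2 * Real.log l, (tendsto_add_atTop_iff_nat 1).1 ?_⟩
    refine ((((Real.continuousAt_log hl.ne').tendsto.comp h)).const_mul (1 / 2)).congr fun n => ?_
    rw [Function.comp, log_normSqProd ha]

lemma HasFiniteLogHamiltonian.tendsto_one (ha : ∀ n, 0 < a n) (h : HasFiniteLogHamiltonian a) :
    Tendsto a atTop (𝓝 1) := by
  obtain ⟨l, hl, h⟩ := (hasFiniteLogHamiltonian_iff ha).1 h
  have h1 := (h.comp (tendsto_add_atTop_nat 1)).div h hl.ne'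
  rw [div_self hl.ne'] at h1
  refine (tendsto_add_atTop_iff_nat 1).1 (h1.congr fun n => ?_)
  simp only [Pi.div_apply, Function.comp]
  rw [normSqProd_succ (n + 1), mul_div_cancel_left₀ _ (normSqProd_pos ha _).ne']

/-- The spectral measure of the Lax operator of a lattice with finite logarithmic Hamiltonian is
compactly supported and admissible, and its moments are the diagonal entries of the powers of the
Lax operator. -/
lemma exists_laxSpectralMeasure (ha : ∀ n, 0 < a n) (hH : HasFiniteLogHamiltonian a) :
    ∃ μ : Measure ℝ, IsLaxSpectralMeasure a μ ∧ IsAdmissible μ ∧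
      (∃ R : ℝ, μ (Icc (-R) R)ᶜ = 0) ∧ ∀ k, momentOf μ k = powerCoeff a k 0 := by
  have hlim : Tendsto (fun n => √(a n)) atTop (𝓝 1) := by
    simpa using (hH.tendsto_one ha).sqrt
  obtain ⟨C, hC⟩ := hlim.bddAbove_range
  have hb : ∀ n, |√(a n)| ≤ C := fun n => by
    rw [abs_of_nonneg (Real.sqrt_nonneg _)]; exact hC ⟨n, rfl⟩
  obtain ⟨μ, hμ⟩ := exists_representsSpectralMeasure
    (isLaxOperator_jacobiOp hb).1 (stdVec 0)
  have := hμ.finite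
  obtain ⟨R, hR⟩ := hμ.bounded
  have hmom : ∀ k, momentOf μ k = powerCoeff a k 0 := fun k => by
    have h := hμ.integral_pow k
    rw [inner_stdVec_left, jacobiOp_pow_stdVec ha hb] at h
    simpa [normSqProd, momentOf] using Complex.ofReal_injective h
  have hfin := fun δ (hδ : δ > 0) => finite_support_outside hlim hμ hδ
  refine ⟨μ, ⟨_, isLaxOperator_jacobiOp hb, hμ.isSpectralMeasureAt⟩, ?_, ⟨R, hR⟩, hmom⟩
  refine ⟨⟨?_⟩, ?_, fun k => integrable_of_continuous_of_compl_Icc hR (continuous_pow k), ?_,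
    countable_outerMassPoints hfin, derivedSet_outerMassPoints hfin, ?_⟩
  · have h := hmom 0
    simp only [momentOf, pow_zero, powerCoeff, if_pos, integral_const, smul_eq_mul, mul_one] at h
    rwa [measureReal_def, ENNReal.toReal_eq_one_iff] at h
  · exact map_neg_eq_self_of_moments hR fun k hk => by
      rw [hmom, powerCoeff_of_odd (by simpa using hk)]
  · exact essentialSupport_eq_Icc
      (Icc_subset_support (fun n => Real.sqrt_pos.2 (ha n)) hlim hμ) hfin
  · obtain ⟨l, hl, h⟩ := (hasFiniteLogHamiltonian_iff ha).1 hH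
    refine ⟨l, hl, h.congr fun n => ?_⟩
    have e : momentOf μ = fun i => powerCoeff a i 0 := funext hmom
    rw [hankelDet_eq_seqHankelDet, hankelDet_eq_seqHankelDet, e, seqHankelDet_powerCoeff_succ,
      mul_div_cancel_left₀ _ (seqHankelDet_powerCoeff_pos ha _).ne']

/-! ### Admissible measures at a fixed time -/

section Admissible

variable {μ : Measure ℝ}

lemma IsAdmissible.seqHankelDet_pos (h : IsAdmissible μ) (n : ℕ) :
    0 < seqHankelDet (momentOf μ) n := by
  refine seqHankelDet_momentOf_pos h.moments ?_ n
  refine (Icc_infinite (by norm_num : (-2 : ℝ) < 2)).mono ?_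
  rw [← h.essential]
  exact inter_subset_left

lemma IsAdmissible.hankelCoeff_pos (h : IsAdmissible μ) (n : ℕ) : 0 < hankelCoeff μ n :=
  div_pos (mul_pos (h.seqHankelDet_pos _) (h.seqHankelDet_pos _)) (pow_pos (h.seqHankelDet_pos _) 2)

lemma IsAdmissible.powerCoeff_hankelCoeff (h : IsAdmissible μ) (k : ℕ) :
    powerCoeff (hankelCoeff μ) k 0 = momentOf μ k := by
  have := h.prob
  exact powerCoeff_seqHankelCoeff (by simp [momentOf]) (fun k hk => momentOf_eq_zero_of_even h.even hk)
    h.seqHankelDet_pos k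

lemma IsAdmissible.hasFiniteLogHamiltonian (h : IsAdmissible μ) :
    HasFiniteLogHamiltonian (hankelCoeff μ) := by
  rw [hasFiniteLogHamiltonian_iff h.hankelCoeff_pos]
  obtain ⟨l, hl, hlim⟩ := h.hankel
  refine ⟨l, hl, hlim.congr fun n => ?_⟩
  have e : momentOf μ = fun i => powerCoeff (hankelCoeff μ) i 0 :=
    funext fun k => (h.powerCoeff_hankelCoeff k).symm
  rw [hankelDet_eq_seqHankelDet, hankelDet_eq_seqHankelDet, e, seqHankelDet_powerCoeff_succ,
    mul_div_cancel_left₀]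
  rw [← e]
  exact (h.seqHankelDet_pos _).ne'

lemma IsAdmissible.eq_of_moments (h : IsAdmissible μ) {ν : Measure ℝ} [IsFiniteMeasure ν]
    (hν : ∃ R : ℝ, ν (Icc (-R) R)ᶜ = 0) (hm : ∀ k, momentOf ν k = momentOf μ k) : ν = μ := by
  have := h.prob
  obtain ⟨R, hR⟩ := hν
  exact measure_ext_of_moments hR h.moments hm

/-- The definition lets mass points escape to infinity. The Hankel condition rules this out: the
Hankel coefficients tend to 1, so their Lax operator is bounded, and its spectral measure has the
same moments as `μ`. -/
lemma IsAdmissible.exists_compl_Icc (h : IsAdmissible μ) : ∃ R : ℝ, μ (Icc (-R) R)ᶜ = 0 := by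
  obtain ⟨ν, -, hν, hR, hm⟩ := exists_laxSpectralMeasure h.hankelCoeff_pos h.hasFiniteLogHamiltonian
  have := hν.prob
  rwa [h.eq_of_moments hR fun k => (hm k).trans (h.powerCoeff_hankelCoeff k)] at hR

lemma hankelCoeff_eq_of_moments (ha : ∀ n, 0 < a n) (hm : ∀ k, momentOf μ k = powerCoeff a k 0)
    (n : ℕ) : hankelCoeff μ n = a n := by
  rw [← seqHankelCoeff_powerCoeff ha n, ← funext hm]
  rfl

end Admissible

/-! ### The time evolution -/

section Evolution

variable {T : EReal}

lemma Icc_subset_timeInterval {b : ℝ} (hb : (b : EReal) < T) : Icc 0 b ⊆ timeInterval T :=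
  fun _ hx => ⟨hx.1, (EReal.coe_le_coe_iff.2 hx.2).trans_lt hb⟩

/-- A primitive of a continuous function on `[0, b]`, exponentiated. -/
lemma exists_exp_primitive {u : ℝ → ℝ} {b : ℝ} (hb : 0 ≤ b) (hu : ContinuousOn u (Icc 0 b)) :
    ∃ E : ℝ → ℝ, E 0 = 1 ∧ (∀ x, 0 < E x) ∧
      ∀ x ∈ Icc 0 b, HasDerivWithinAt E (u x * E x) (Icc 0 b) x := by
  set w := IccExtend hb ((Icc 0 b).domRestrict u)
  have hw : Continuous w := (continuousOn_iff_continuous_domRestrict.1 hu).Icc_extend'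
  refine ⟨fun x => Real.exp (∫ s in (0 : ℝ)..x, w s), by simp, fun x => Real.exp_pos _,
    fun x hx => ?_⟩
  have h1 := (hw.integral_hasStrictDerivAt 0 x).hasDerivAt.exp
  refine h1.hasDerivWithinAt.congr_deriv ?_
  rw [show w x = u x from IccExtend_of_mem _ _ hx, mul_comm]

/-- Along the Volterra flow the moments `c_{k,0}` evolve as those of the measures
`e^{x² t} dμ / ∫ e^{x² t} dμ`. -/
lemma powerCoeff_eq_expMoment_div {A : ℝ → ℕ → ℝ}
    (hpos : ∀ x ∈ timeInterval T, ∀ n, 0 < A x n)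
    (hA : ∀ x ∈ timeInterval T, ∀ n, HasDerivWithinAt (fun x => A x n)
      (A x n * (A x (n + 1) - leftNeighbour (A x) n)) (timeInterval T) x)
    {μ : Measure ℝ} [IsFiniteMeasure μ] {R : ℝ} (hR : μ (Icc (-R) R)ᶜ = 0)
    (hm : ∀ k, momentOf μ k = powerCoeff (A 0) k 0) {t : ℝ} (ht : t ∈ timeInterval T) (k : ℕ) :
    powerCoeff (A t) (2 * k) 0 = expMoment μ (2 * k) t / expMoment μ 0 t := by
  obtain ⟨b, htb, hbT⟩ := EReal.lt_iff_exists_real_btwn.1 ht.2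
  rw [EReal.coe_lt_coe_iff] at htb
  have hb : 0 ≤ b := ht.1.trans htb.le
  have hsub := Icc_subset_timeInterval hbT
  -- Since s_2 = a_0, the integrating factor exp ∫ a_0 cancels the term -s_2 s_k in the moment
  -- equation.
  obtain ⟨E, hE0, hEpos, hE⟩ := exists_exp_primitive hb
    (u := fun x => A x 0) fun x hx => ((hA x (hsub hx) 0).mono hsub).continuousWithinAt
  have key := eq_of_absolutelyMonotone (f := fun k x => powerCoeff (A x) (2 * k) 0 * E x)
    (g := fun k x => expMoment μ (2 * k) x) (b := b) (t := t)
    (fun k x hx => by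
      refine ((((hasDerivWithinAt_powerCoeff (hA x (hsub hx)) (2 * k) 0).mono hsub)).mul
        (hE x hx)).congr_deriv ?_
      rw [show 2 * (k + 1) = 2 * k + 2 by ring, powerCoeff_add_two_zero]
      ring)
    (fun k x hx => mul_nonneg (powerCoeff_nonneg (fun n => (hpos x (hsub hx) n).le) _ _)
      (hEpos x).le)
    (fun k x _ => (hasDerivAt_expMoment hR (2 * k) x).hasDerivWithinAt)
    (fun k x _ => expMoment_even_nonneg μ k x)
    (fun k => by simp only [hE0, mul_one]; rw [expMoment_zero_right, hm]) ht.1 htb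
  -- As s_0 = 1, the case `k = 0` identifies the integrating factor with the normalizing integral.
  have h0 : E t = expMoment μ 0 t := by simpa [powerCoeff] using key 0
  rw [← key k, ← h0, mul_div_cancel_right₀ _ (hEpos t).ne']

lemma extend_val_apply {β : Type*} [Zero β] (a : timeInterval T → β) (t : timeInterval T) :
    Function.extend Subtype.val a 0 (t : ℝ) = a t :=
  Subtype.val_injective.extend_apply _ _ _

/-- The lattice extended by zero to all real times. -/
def extendLattice (a : timeInterval T → ℕ → ℝ) (x : ℝ) (n : ℕ) : ℝ :=
  Function.extend Subtype.val (fun s : timeInterval T => a s n) 0 x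

lemma extendLattice_coe (a : timeInterval T → ℕ → ℝ) (t : timeInterval T) :
    extendLattice a t = a t :=
  funext fun n => extend_val_apply (fun s : timeInterval T => a s n) t

lemma extendLattice_of_mem (a : timeInterval T → ℕ → ℝ) {x : ℝ} (hx : x ∈ timeInterval T) :
    extendLattice a x = a ⟨x, hx⟩ :=
  extendLattice_coe a ⟨x, hx⟩

/-- The spectral measures of a lattice evolve by `dμ_t = e^{x² t} dμ_0 / ∫ e^{x² t} dμ_0`. -/
lemma IsVolterraLattice.eq_expTilt (hT : 0 < T) {a : timeInterval T → ℕ → ℝ}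
    (ha : IsVolterraLattice T a) {μ : timeInterval T → Measure ℝ}
    (hadm : ∀ t, IsAdmissible (μ t)) (hm : ∀ t k, momentOf (μ t) k = powerCoeff (a t) k 0)
    (t : timeInterval T) : μ t = expTilt (μ (initialTime hT)) t := by
  have := (hadm (initialTime hT)).prob
  obtain ⟨R, hR⟩ := (hadm (initialTime hT)).exists_compl_Icc
  have := isFiniteMeasure_expTilt hR t
  refine ((hadm t).eq_of_moments ⟨R, expTilt_compl_Icc hR t⟩ fun k => ?_).symm
  rw [momentOf_expTilt]
  rcases Nat.even_or_odd' k with ⟨k, rfl | rfl⟩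
  · rw [hm, ← powerCoeff_eq_expMoment_div (A := extendLattice a) _ _ hR _ t.2, extendLattice_coe]
    · intro x hx n
      rw [extendLattice_of_mem a hx]
      exact ha.pos _ n
    · intro x hx n
      rw [extendLattice_of_mem a hx]
      exact ha.ode ⟨x, hx⟩ n
    · intro k
      have e : extendLattice a 0 = a (initialTime hT) := extendLattice_coe a (initialTime hT)
      rw [e, hm]
  · rw [expMoment_eq_zero_of_even (hadm _).even ⟨k, rfl⟩, zero_div,
      momentOf_eq_zero_of_even (hadm t).even ⟨k, rfl⟩]

/-- The Hankel coefficients of an admissible family solve the Volterra equations. -/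
lemma isVolterraLattice_hankelCoeff (hT : 0 < T) {ρ : timeInterval T → Measure ℝ}
    (hρ : ρ ∈ AdmissibleFamilies T hT) : IsVolterraLattice T fun t => hankelCoeff (ρ t) := by
  obtain ⟨hev, hadm⟩ := hρ
  refine ⟨fun t n => (hadm t).hankelCoeff_pos n, fun t n => ?_⟩
  have := (hadm (initialTime hT)).prob
  obtain ⟨R, hR⟩ := (hadm (initialTime hT)).exists_compl_Icc
  set ν := ρ (initialTime hT)
  set A := extendLattice fun t => hankelCoeff (ρ t) with hA
  have hAt : A t = hankelCoeff (ρ t) := extendLattice_coe _ t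
  have hs : ∀ x ∈ timeInterval T, ∀ k,
      powerCoeff (A x) k 0 = expMoment ν k x / expMoment ν 0 x := by
    intro x hx k
    rw [hA, extendLattice_of_mem _ hx, (hadm ⟨x, hx⟩).powerCoeff_hankelCoeff, hev ⟨x, hx⟩]
    exact momentOf_expTilt ν x k
  rw [← hAt]
  refine hasDerivWithinAt_of_powerCoeff (A := A) t.2 (fun x hx n => ?_) (fun k => ?_) n
  · rw [hA, extendLattice_of_mem _ hx]
    exact (hadm ⟨x, hx⟩).hankelCoeff_pos n
  · have hne := (expMoment_zero_pos hR t).ne'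
    -- The quotient rule for m_k/m_0 with m_k' = m_{k+2} is precisely the moment equation.
    refine ((((hasDerivAt_expMoment hR k t).div (hasDerivAt_expMoment hR 0 t)
      hne).hasDerivWithinAt).congr_of_mem (fun x hx => hs x hx k) t.2).congr_deriv ?_
    rw [hs t t.2, hs t t.2, hs t t.2]
    field_simp

end Evolution

/-! ### The correspondence -/

section Correspondence

variable {T : EReal}

/-- The spectral measures of the Lax operators of a lattice with finite Hamiltonian. -/
def laxMeasures (a : FiniteHamiltonianLattices T) (t : timeInterval T) : Measure ℝ :=
  (exists_laxSpectralMeasure (a.2.1.pos t) (a.2.2 t)).choose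

lemma laxMeasures_spec (a : FiniteHamiltonianLattices T) (t : timeInterval T) :
    IsLaxSpectralMeasure (a.1 t) (laxMeasures a t) ∧ IsAdmissible (laxMeasures a t) ∧
      (∃ R : ℝ, laxMeasures a t (Icc (-R) R)ᶜ = 0) ∧
      ∀ k, momentOf (laxMeasures a t) k = powerCoeff (a.1 t) k 0 :=
  (exists_laxSpectralMeasure (a.2.1.pos t) (a.2.2 t)).choose_spec

/-- The bijection between lattices with finite Hamiltonian and admissible families. -/
def latticeEquivFamilies (hT : 0 < T) : FiniteHamiltonianLattices T ≃ AdmissibleFamilies T hT where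
  toFun a := ⟨laxMeasures a,
    a.2.1.eq_expTilt hT (fun t => (laxMeasures_spec a t).2.1)
      fun t => (laxMeasures_spec a t).2.2.2,
    fun t => (laxMeasures_spec a t).2.1⟩
  invFun ρ := ⟨fun t => hankelCoeff (ρ.1 t), isVolterraLattice_hankelCoeff hT ρ.2,
    fun t => (ρ.2.2 t).hasFiniteLogHamiltonian⟩
  left_inv a := Subtype.ext <| funext fun t => funext fun n =>
    hankelCoeff_eq_of_moments (a.2.1.pos t) (laxMeasures_spec a t).2.2.2 n
  right_inv ρ := Subtype.ext <| funext fun t => by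
    set a : FiniteHamiltonianLattices T := ⟨fun t => hankelCoeff (ρ.1 t),
      isVolterraLattice_hankelCoeff hT ρ.2, fun t => (ρ.2.2 t).hasFiniteLogHamiltonian⟩
    obtain ⟨-, hadm, hR, hm⟩ := laxMeasures_spec a t
    have := hadm.prob
    exact (ρ.2.2 t).eq_of_moments hR fun k =>
      (hm k).trans ((ρ.2.2 t).powerCoeff_hankelCoeff k)

end Correspondence

end
/-- The one-to-one correspondence `Φ` between semi-infinite Volterra lattices with finite
logarithmic Hamiltonian and admissible families of measures: `Φ` sends a lattice to the spectral
measures of its Lax operators, and its inverse is `a_n = Δ_{n+1} Δ_{n-1} / Δ_n²`. -/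
theorem theorem2 (T : EReal) (hT : 0 < T) :
    ∃ Φ : FiniteHamiltonianLattices T ≃ AdmissibleFamilies T hT,
      (∀ (a : FiniteHamiltonianLattices T) (t : timeInterval T),
        IsLaxSpectralMeasure (a.1 t) ((Φ a).1 t)) ∧
      (∀ (ρ : AdmissibleFamilies T hT) (t : timeInterval T) (n : ℕ),
        (Φ.symm ρ).1 t n = hankelCoeff (ρ.1 t) n) :=
  ⟨latticeEquivFamilies hT, fun a t => (laxMeasures_spec a t).1, fun _ _ _ => rfl⟩
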